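/- Let $p>1$ and $C_o>0$. There is a constant $C>0$ depending only on $p$ and $C_o$ with the following property. Let $E\subset\mathbb{R}^N$ be a bounded open set, $k\in\mathbb N$, $T>0$, $E_T:=E\times(0,T]$, $\mu\in(0,1]$, and let $a,b\in L^\infty(E_T)$ satisfy $C_o\le a\le C_1$ for some constant $C_1$ and $b\ge C_o$ a.e. in $E_T$. Let $$v\in C([0,T];L^2(E,\mathbb{R}^k))\cap L^p(0,T;W^{1,p}(E,\mathbb{R}^k))$$ be a weak solution of $\partial_t v-\operatorname{div}\big(a(x,t)(\mu^2+|Dv|^2)^{\frac{p-2}{2}}Dv\big)=0$ in $E_T$, that is, $$\iint_{E_T}\Big[v\cdot\partial_t\zeta-a\,(\mu^2+|Dv|^2)^{\frac{p-2}{2}}Dv\cdot D\zeta\Big]\,dx\,dt=0$$ for all $\zeta\in W^{1,2}(0,T;L^2(E,\mathbb{R}^k))\cap L^p(0,T;W^{1,p}_0(E,\mathbb{R}^k))$ with $\zeta(\cdot,0)=\zeta(\cdot,T)=0$. Let $w$ be a weak solution of the Cauchy–Dirichlet problem $$\partial_t w-\operatorname{div}\big(b(x,t)(\mu^2+|Dw|^2)^{\frac{p-2}{2}}Dw\big)=0\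 \text{ in }E_T,\qquad w=v\ \text{ on }\partial E\times(0,T],\qquad w(\cdot,0)=v(\cdot,0)\ \text{ in }E,$$ that is, $w\in C([0,T];L^2(E,\mathbb{R}^k))\cap\big(v+L^p(0,T;W^{1,p}_0(E,\mathbb{R}^k))\big)$ and $$\iint_{E_T}\Big[(v(\cdot,0)-w)\cdot\partial_t\zeta+b\,(\mu^2+|Dw|^2)^{\frac{p-2}{2}}Dw\cdot D\zeta\Big]\,dx\,dt=0$$ for all $\zeta\in W^{1,2}(0,T;L^2(E,\mathbb{R}^k))\cap L^p(0,T;W^{1,p}_0(E,\mathbb{R}^k))$ with $\zeta(\cdot,T)=0$. Put $\mathsf A:=\|a-b\|_{L^\infty(E_T)}$. Then $$\iint_{E_T}|Dv-Dw|^p\,dx\,dt\le C\big[\mathsf A^p+\mathsf A^{\frac{p}{p-1}}\big]\iint_{E_T}(\mu^2+|Dv|^2)^{\frac p2}\,dx\,dt .$$ If $p\ge2$, then moreover $$\iint_{E_T}|Dv-Dw|^p\,dx\,dt\le C\,\mathsf A^{\frac{p}{p-1}}\iint_{E_T}(\mu^2+|Dv|^2)^{\frac p2}\,dx\,dt .$$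 Furthermore, for every $p>1$, $$\iint_{E_T}(\mu^2+|Dw|^2)^{\frac p2}\,dx\,dt\le C\big[1+\mathsf A^p+\mathsf A^{\frac{p}{p-1}}\big]\iint_{E_T}(\mu^2+|Dv|^2)^{\frac p2}\,dx\,dt .$$ -/

import Mathlib

open MeasureTheory Set Filter Topology
open scoped ENNReal ContDiff

namespace ParabolicSystem

noncomputable section

/-- Euclidean `n`-space. -/
abbrev Euc (n : ℕ) : Type := EuclideanSpace ℝ (Fin n)

/-- The space `ℝ^{kN}` of gradients with the Euclidean norm and inner product;
the entry `(j, i)` stands for `∂_i u_j`. -/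
abbrev GradSpace (k N : ℕ) : Type := EuclideanSpace ℝ (Fin k × Fin N)

/-- The space-time cylinder `E_T = E × (0, T]`. -/
def cylinder {N : ℕ} (E : Set (Euc N)) (T : ℝ) : Set (Euc N × ℝ) := E ×ˢ Ioc 0 T

/-- Lebesgue measure on `E_T`. -/
def cylinderMeasure {N : ℕ} (E : Set (Euc N)) (T : ℝ) : Measure (Euc N × ℝ) :=
  volume.restrict (cylinder E T)

/-- `φ ∈ C_c^∞(U, Y)`. -/
structure IsSmoothCompact {X Y : Type*} [NormedAddCommGroup X] [NormedSpace ℝ X]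
    [NormedAddCommGroup Y] [NormedSpace ℝ Y] (U : Set X) (φ : X → Y) : Prop where
  smooth : ContDiff ℝ ∞ φ
  compact : HasCompactSupport φ
  support : tsupport φ ⊆ U

/-- The classical partial derivative `∂_i φ`. -/
def partialDeriv {N : ℕ} {Y : Type*} [NormedAddCommGroup Y] [NormedSpace ℝ Y]
    (i : Fin N) (φ : Euc N → Y) (x : Euc N) : Y :=
  fderiv ℝ φ x (EuclideanSpace.single i 1)

/-- The classical gradient `(∂_i φ_j)_{j,i}` of a vector-valued function. -/
def classicalGrad {N k : ℕ} (φ : Euc N → Euc k) (x : Euc N) : GradSpace k N :=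
  WithLp.toLp 2 fun ji => partialDeriv ji.2 φ x ji.1

/-- `u ∈ W^{1,p}(E, ℝ^k)` with weak gradient `Du`. -/
structure MemSobolev {N k : ℕ} (E : Set (Euc N)) (p : ℝ)
    (u : Euc N → Euc k) (Du : Euc N → GradSpace k N) : Prop where
  memLp : MemLp u (ENNReal.ofReal p) (volume.restrict E)
  memLp_grad : MemLp Du (ENNReal.ofReal p) (volume.restrict E)
  weakGrad : ∀ φ : Euc N → ℝ, IsSmoothCompact E φ → ∀ (j : Fin k) (i : Fin N),
    ∫ x in E, u x j * partialDeriv i φ x = -∫ x in E, Du x (j, i) * φ x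

/-- `u ∈ W_0^{1,p}(E, ℝ^k)`, the closure of `C_c^∞(E, ℝ^k)` in `W^{1,p}(E, ℝ^k)`,
with weak gradient `Du`. -/
structure MemSobolevZero {N k : ℕ} (E : Set (Euc N)) (p : ℝ)
    (u : Euc N → Euc k) (Du : Euc N → GradSpace k N) : Prop
    extends MemSobolev E p u Du where
  approx : ∀ ε : ℝ, 0 < ε → ∃ φ : Euc N → Euc k, IsSmoothCompact E φ ∧
    eLpNorm (fun x => u x - φ x) (ENNReal.ofReal p) (volume.restrict E) ≤ ENNReal.ofReal ε ∧
    eLpNorm (fun x => Du x - classicalGrad φ x) (ENNReal.ofReal p) (volume.restrict E)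
      ≤ ENNReal.ofReal ε

/-- `u ∈ L^p(0, T; W^{1,p}(E, ℝ^k))` with spatial weak gradient `Du`. -/
structure MemLpSobolev {N k : ℕ} (E : Set (Euc N)) (T p : ℝ)
    (u : Euc N × ℝ → Euc k) (Du : Euc N × ℝ → GradSpace k N) : Prop where
  memLp : MemLp u (ENNReal.ofReal p) (cylinderMeasure E T)
  memLp_grad : MemLp Du (ENNReal.ofReal p) (cylinderMeasure E T)
  slice : ∀ᵐ t ∂(volume.restrict (Ioc 0 T)),
    MemSobolev E p (fun x => u (x, t)) (fun x => Du (x, t))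

/-- `u ∈ L^p(0, T; W_0^{1,p}(E, ℝ^k))` with spatial weak gradient `Du`. -/
structure MemLpSobolevZero {N k : ℕ} (E : Set (Euc N)) (T p : ℝ)
    (u : Euc N × ℝ → Euc k) (Du : Euc N × ℝ → GradSpace k N) : Prop where
  memLp : MemLp u (ENNReal.ofReal p) (cylinderMeasure E T)
  memLp_grad : MemLp Du (ENNReal.ofReal p) (cylinderMeasure E T)
  slice : ∀ᵐ t ∂(volume.restrict (Ioc 0 T)),
    MemSobolevZero E p (fun x => u (x, t)) (fun x => Du (x, t))

/-- `u ∈ C([0, T]; L²(E, ℝ^k))`. -/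
structure ContinuousInL2 {N k : ℕ} (E : Set (Euc N)) (T : ℝ) (u : Euc N × ℝ → Euc k) :
    Prop where
  memLp : ∀ t ∈ Icc 0 T, MemLp (fun x => u (x, t)) 2 (volume.restrict E)
  tendsto : ∀ t ∈ Icc 0 T,
    Tendsto (fun s => eLpNorm (fun x => u (x, s) - u (x, t)) 2 (volume.restrict E))
      (𝓝[Icc 0 T] t) (𝓝 0)

/-- `ζ ∈ W^{1,2}(0, T; L²(E, ℝ^k))` with weak time derivative `ζt`, where `ζ` is the
representative in `C([0, T]; L²(E, ℝ^k))`, so that `ζ(·, 0)` and `ζ(·, T)` make sense. -/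
structure MemW12L2 {N k : ℕ} (E : Set (Euc N)) (T : ℝ) (ζ ζt : Euc N × ℝ → Euc k) :
    Prop where
  memLp : MemLp ζ 2 (cylinderMeasure E T)
  memLp_deriv : MemLp ζt 2 (cylinderMeasure E T)
  weakDeriv : ∀ η : ℝ → ℝ, IsSmoothCompact (Ioo 0 T) η →
    ∀ᵐ x ∂(volume.restrict E),
      ∫ t in Ioc 0 T, deriv η t • ζ (x, t) = -∫ t in Ioc 0 T, η t • ζt (x, t)
  continuous : ContinuousInL2 E T ζ

/-- `ζ ∈ W^{1,2}(0, T; L²(E, ℝ^k)) ∩ L^p(0, T; W_0^{1,p}(E, ℝ^k))` with `ζ(·, T) = 0`;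
`Dζ` is its spatial weak gradient and `ζt` its weak time derivative. -/
structure IsTestFunction {N k : ℕ} (E : Set (Euc N)) (T p : ℝ)
    (ζ : Euc N × ℝ → Euc k) (Dζ : Euc N × ℝ → GradSpace k N) (ζt : Euc N × ℝ → Euc k) :
    Prop where
  time : MemW12L2 E T ζ ζt
  space : MemLpSobolevZero E T p ζ Dζ
  final : ∀ᵐ x ∂(volume.restrict E), ζ (x, T) = 0

/-- The vector field `ξ ↦ (μ² + |ξ|²)^{(p-2)/2} ξ`. -/
def flux {k N : ℕ} (p μ : ℝ) (ξ : GradSpace k N) : GradSpace k N :=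
  (μ ^ 2 + ‖ξ‖ ^ 2) ^ ((p - 2) / 2) • ξ

/-- `u`, with spatial weak gradient `Du`, is a weak solution of
`∂_t u - div (a(x,t) (μ² + |Du|²)^{(p-2)/2} Du) = 0` in `E_T`. -/
structure IsWeakSolution {N k : ℕ} (E : Set (Euc N)) (T p μ : ℝ) (a : Euc N × ℝ → ℝ)
    (u : Euc N × ℝ → Euc k) (Du : Euc N × ℝ → GradSpace k N) : Prop where
  continuous : ContinuousInL2 E T u
  sobolev : MemLpSobolev E T p u Du
  weakForm : ∀ (ζ : Euc N × ℝ → Euc k) (Dζ : Euc N × ℝ → GradSpace k N)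
    (ζt : Euc N × ℝ → Euc k), IsTestFunction E T p ζ Dζ ζt →
    (∀ᵐ x ∂(volume.restrict E), ζ (x, 0) = 0) →
    ∫ z, (inner ℝ (u z) (ζt z) - a z * inner ℝ (flux p μ (Du z)) (Dζ z))
      ∂(cylinderMeasure E T) = 0

/-- `u`, with spatial weak gradient `Du`, is a weak solution of the Cauchy–Dirichlet problem
`∂_t u - div (b(x,t) (μ² + |Du|²)^{(p-2)/2} Du) = 0` in `E_T`, `u = g` on `∂E × (0, T]`,
`u(·, 0) = u₀` in `E`; `Dg` is the spatial weak gradient of `g`. -/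
structure IsCauchyDirichletSolution {N k : ℕ} (E : Set (Euc N)) (T p μ : ℝ)
    (b : Euc N × ℝ → ℝ) (g : Euc N × ℝ → Euc k) (Dg : Euc N × ℝ → GradSpace k N)
    (u₀ : Euc N → Euc k)
    (u : Euc N × ℝ → Euc k) (Du : Euc N × ℝ → GradSpace k N) : Prop where
  continuous : ContinuousInL2 E T u
  sobolev : MemLpSobolev E T p u Du
  boundary : MemLpSobolevZero E T p (fun z => u z - g z) (fun z => Du z - Dg z)
  weakForm : ∀ (ζ : Euc N × ℝ → Euc k) (Dζ : Euc N × ℝ → GradSpace k N)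
    (ζt : Euc N × ℝ → Euc k), IsTestFunction E T p ζ Dζ ζt →
    ∫ z, (inner ℝ (u₀ z.1 - u z) (ζt z) + b z * inner ℝ (flux p μ (Du z)) (Dζ z))
      ∂(cylinderMeasure E T) = 0

/-- The norm of `f` in `L^∞(E_T)`. -/
def supNorm {N : ℕ} (E : Set (Euc N)) (T : ℝ) (f : Euc N × ℝ → ℝ) : ℝ :=
  (eLpNorm f ∞ (cylinderMeasure E T)).toReal

/-- The energy `∬_{E_T} (μ² + |G|²)^{p/2} dx dt`. -/
def energy {N k : ℕ} (E : Set (Euc N)) (T p μ : ℝ) (G : Euc N × ℝ → GradSpace k N) : ℝ :=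
  ∫ z, (μ ^ 2 + ‖G z‖ ^ 2) ^ (p / 2) ∂(cylinderMeasure E T)

end

end ParabolicSystem

/-! Write A(ξ) = (μ² + |ξ|²)^((p-2)/2) ξ and u = w - v. Formally, testing the difference of the two
equations with u, which vanishes on the lateral boundary and at t = 0, gives ½‖u(T)‖² + ∬ ⟨bA(Dw) -
aA(Dv), Dw - Dv⟩ = 0, so the double integral is nonpositive (`integral_inner_flux_sub_nonpos`).
Splitting bA(Dw) - aA(Dv) = b(A(Dw) - A(Dv)) + (b - a)A(Dv) separates a monotone term, bounded below
because b ≥ C₀, from an error of size ‖a - b‖ |A(Dv)| |Dw - Dv|. Strong monotonicity of A and a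
Young-type absorption then give, pointwise, |ξ - η|^p ≤ Λ · (monotone quantity) + B (μ² +
|η|²)^(p/2) (`norm_sub_rpow_le`, `norm_sub_rpow_le_sub`). After integration the Λ term has a
favourable sign, so only B enters the final constant; Λ may depend on ‖a - b‖.

The difficulty is that u has no time derivative in L². For each fixed s the product k_h(t - s) u(x,
s), with k_h an even C¹ kernel, is an admissible test function. Integrating the tested equation over
s ∈ (h, T - h) produces ∬ k_h'(t - s) ⟨u(t), u(s)⟩ dt ds on the time side. Its integrand is
antisymmetric in (t, s), so the integral over the central square vanishes. The strip near t = 0 is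
small because u(0) = 0, and the strip near t = T is almost nonpositive because k_h' ≤ 0 for t ≥ s
while ⟨u(t), u(s)⟩ is close to ‖u(T)‖² (`exists_integral_inner_timeKernelDeriv_le`). The flux side
converges to a positive multiple of the desired integral (`exists_abs_mollified_pairing_sub_le`).
The identity u(0) = 0 must itself be extracted from the weak form (`initial_sub_eq_zero`). -/

namespace ParabolicSystem

/-! ### Pointwise inequalities: absorption and strong monotonicity -/

/-- Absorption inequality in the superquadratic range. -/
lemma rpow_le_absorb {p z B : ℝ} (hp : 1 < p) (hz : 0 ≤ z) (hB : 0 < B) :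
    z ^ p ≤ 2 * (z ^ p - B * z / 2) + B ^ (p / (p - 1)) := by
  have hp1 : 0 < p - 1 := by linarith
  have hBp : 0 ≤ B ^ (p / (p - 1)) := by positivity
  rcases hz.eq_or_lt with rfl | hz
  · simpa [Real.zero_rpow (by linarith : p ≠ 0)] using hBp
  -- Either the linear term is absorbed by z^p, or z^(p-1) ≤ B and then Bz ≤ B^(p/(p-1)).
  rcases le_total (B * z) (z ^ p) with h | h
  · linarith
  · have hzp : z ^ p = z ^ (p - 1) * z := by
      rw [← Real.rpow_add_one hz.ne']; congr 1; ring
    have h1 : z ^ (p - 1) ≤ B := by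
      rw [hzp] at h; exact le_of_mul_le_mul_right h hz
    have h2 : z ≤ B ^ (1 / (p - 1)) := by
      rw [one_div, Real.le_rpow_inv_iff_of_pos hz.le hB.le hp1]; exact h1
    have h3 : B * z ≤ B ^ (p / (p - 1)) := by
      have : p / (p - 1) = 1 + 1 / (p - 1) := by field_simp; ring
      rw [this, Real.rpow_add hB, Real.rpow_one]
      gcongr
    have : 0 ≤ z ^ p := by positivity
    linarith

/-- Absorption inequality in the subquadratic range. -/
lemma rpow_le_absorb_sub {p z B m : ℝ} (hp : 1 < p) (hp2 : p < 2) (hz : 0 ≤ z) (hB : 0 < B)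
    (hm1 : z ≤ 1 → z ^ 2 ≤ m) (hm2 : 1 ≤ z → z ^ p ≤ m) :
    z ^ p ≤ 2 * (1 + B ^ (p - 2)) * (m - B * z / 2) + 4 * (B ^ p + B ^ (p / (p - 1))) := by
  have hp1 : 0 < p - 1 := by linarith
  have hB1 : 0 ≤ B ^ (p / (p - 1)) := by positivity
  have hB2 : 0 ≤ B ^ p := by positivity
  have hB3 : 0 ≤ B ^ (p - 2) := by positivity
  have hBp : B ^ p = B ^ (p - 2) * B ^ 2 := by
    rw [← Real.rpow_natCast B 2, ← Real.rpow_add hB]; congr 1; norm_num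
  have hBq : B ^ (p / (p - 1)) = B * B ^ (1 / (p - 1)) := by
    have : p / (p - 1) = 1 + 1 / (p - 1) := by field_simp; ring
    rw [this, Real.rpow_add hB, Real.rpow_one]
  -- For 1 < p < 2 the exponent 2 lies between p and p/(p-1).
  have hB4 : B ^ 2 ≤ B ^ p + B ^ (p / (p - 1)) := by
    rcases le_total B 1 with h | h
    · have : B ^ (2 : ℝ) ≤ B ^ p := Real.rpow_le_rpow_of_exponent_ge hB h hp2.le
      rw [Real.rpow_two] at this; linarith
    · have : B ^ (2 : ℝ) ≤ B ^ (p / (p - 1)) :=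
        Real.rpow_le_rpow_of_exponent_le h (by rw [le_div_iff₀ hp1]; linarith)
      rw [Real.rpow_two] at this; linarith
  rcases hz.eq_or_lt with rfl | hz
  · have := hm1 zero_le_one
    rw [Real.zero_rpow (by linarith : p ≠ 0)]
    have : 0 ≤ m := by linarith [sq_nonneg (0 : ℝ)]
    simp only [mul_zero, zero_div, sub_zero]
    positivity
  have hzp : z ^ p = z ^ (p - 2) * z ^ 2 := by
    rw [← Real.rpow_natCast z 2, ← Real.rpow_add hz]; congr 1; norm_num
  have hzp' : z ^ p = z ^ (p - 1) * z := by
    rw [← Real.rpow_add_one hz.ne']; congr 1; ring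
  -- The right side increases with m, so m may be replaced by its lower bound, z² or z^p. The factor
  -- B^(p-2) pays for trading z^p against z² when B ≤ z ≤ 1.
  have key : ∀ M ≤ m, z ^ p ≤ 2 * (1 + B ^ (p - 2)) * (M - B * z / 2)
        + 4 * (B ^ p + B ^ (p / (p - 1))) →
      z ^ p ≤ 2 * (1 + B ^ (p - 2)) * (m - B * z / 2) + 4 * (B ^ p + B ^ (p / (p - 1))) := by
    intro M hM h
    refine h.trans ?_
    gcongr
  rcases le_total z 1 with h1 | h1
  · refine key _ (hm1 h1) ?_
    rcases le_total (B * z) (z ^ 2) with h | h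
    · have hBz : B ≤ z := by nlinarith
      have h2 : z ^ (p - 2) ≤ B ^ (p - 2) :=
        Real.rpow_le_rpow_of_nonpos hB hBz (by linarith)
      have h3 : z ^ p ≤ B ^ (p - 2) * z ^ 2 := by rw [hzp]; gcongr
      have h4 : (1 + B ^ (p - 2)) * (z ^ 2) ≤ 2 * (1 + B ^ (p - 2)) * (z ^ 2 - B * z / 2) := by
        have : 0 ≤ (1 + B ^ (p - 2)) * (z ^ 2 - B * z) := by
          apply mul_nonneg <;> linarith
        linarith
      nlinarith [sq_nonneg z]
    · have hBz : z ≤ B := by nlinarith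
      have h2 : z ^ p ≤ B ^ p := by gcongr
      have h3 : B * z ≤ B ^ 2 := by nlinarith
      have h4 : (1 + B ^ (p - 2)) * (B * z) ≤ (1 + B ^ (p - 2)) * B ^ 2 := by gcongr
      have h5 : 0 ≤ (1 + B ^ (p - 2)) * z ^ 2 := by positivity
      nlinarith
  · refine key _ (hm2 h1) ?_
    have hz0 : 0 ≤ z ^ p := by positivity
    rcases le_total (B * z) (z ^ p) with h | h
    · have : 0 ≤ (1 + B ^ (p - 2)) * (z ^ p - B * z) := by
        apply mul_nonneg <;> linarith
      have : 0 ≤ B ^ (p - 2) * z ^ p := by positivity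
      nlinarith
    · have h2 : z ^ (p - 1) ≤ B := by
        rw [hzp'] at h; exact le_of_mul_le_mul_right h hz
      have hB1' : 1 ≤ B := (Real.one_le_rpow h1 hp1.le).trans h2
      have h3 : z ≤ B ^ (1 / (p - 1)) := by
        rw [one_div, Real.le_rpow_inv_iff_of_pos hz.le hB.le hp1]; exact h2
      have h4 : B * z ≤ B ^ (p / (p - 1)) := by rw [hBq]; gcongr
      have h5 : B ^ (p - 2) ≤ 1 := Real.rpow_le_one_of_one_le_of_nonpos hB1' (by linarith)
      have h6 : B ^ (p - 2) * (B * z) ≤ 1 * (B * z) := by gcongr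
      have : 0 ≤ B ^ (p - 2) * z ^ p := by positivity
      nlinarith

section
variable {H : Type*} [NormedAddCommGroup H] [InnerProductSpace ℝ H]

/-- Split the weights into mean and half-difference: αξ - βη = (α+β)/2 (ξ-η) + (α-β)/2 (ξ+η), and
use ⟨ξ+η, ξ-η⟩ = |ξ|² - |η|². -/
lemma inner_smul_sub_smul (α β : ℝ) (ξ η : H) :
    inner ℝ (α • ξ - β • η) (ξ - η)
      = (α + β) / 2 * ‖ξ - η‖ ^ 2 + (α - β) / 2 * (‖ξ‖ ^ 2 - ‖η‖ ^ 2) := by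
  rw [@norm_sub_sq ℝ]
  simp only [inner_sub_left, inner_sub_right, real_inner_smul_left, real_inner_self_eq_norm_sq,
    real_inner_comm ξ η, RCLike.re_to_real]
  ring

/-- Strong monotonicity of `ξ ↦ (μ² + |ξ|²)^{(p-2)/2} ξ` for `p ≥ 2`. -/
lemma inner_flux_sub_ge {p μ : ℝ} (hp : 2 ≤ p) (ξ η : H) :
    (1 / 2) ^ (p - 1) * ‖ξ - η‖ ^ p ≤
      inner ℝ ((μ ^ 2 + ‖ξ‖ ^ 2) ^ ((p - 2) / 2) • ξ - (μ ^ 2 + ‖η‖ ^ 2) ^ ((p - 2) / 2) • η)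
        (ξ - η) := by
  have main : ∀ ξ η : H, ‖η‖ ≤ ‖ξ‖ → (1 / 2) ^ (p - 1) * ‖ξ - η‖ ^ p ≤
      inner ℝ ((μ ^ 2 + ‖ξ‖ ^ 2) ^ ((p - 2) / 2) • ξ - (μ ^ 2 + ‖η‖ ^ 2) ^ ((p - 2) / 2) • η)
        (ξ - η) := by
    intro ξ η h
    rw [inner_smul_sub_smul]
    set α := (μ ^ 2 + ‖ξ‖ ^ 2) ^ ((p - 2) / 2) with hα
    set β := (μ ^ 2 + ‖η‖ ^ 2) ^ ((p - 2) / 2) with hβ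
    have hβα : β ≤ α := by
      apply Real.rpow_le_rpow (by positivity) _ (by linarith)
      gcongr
    have hβ0 : 0 ≤ β := by positivity
    have h1 : 0 ≤ (α - β) / 2 * (‖ξ‖ ^ 2 - ‖η‖ ^ 2) := by
      apply mul_nonneg
      · linarith
      · have : ‖η‖ ^ 2 ≤ ‖ξ‖ ^ 2 := by gcongr
        linarith
    -- The longer vector has at least half the length of the difference, so its weight alone
    -- controls |ξ - η|^(p-2).
    have hd : ‖ξ - η‖ / 2 ≤ ‖ξ‖ := by linarith [norm_sub_le ξ η]
    have h2 : (‖ξ - η‖ / 2) ^ (p - 2) ≤ α := by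
      have : (‖ξ - η‖ / 2) ^ (p - 2) = ((‖ξ - η‖ / 2) ^ 2) ^ ((p - 2) / 2) := by
        rw [← Real.rpow_natCast, ← Real.rpow_mul (by positivity)]
        congr 1; push_cast; ring
      rw [this]
      apply Real.rpow_le_rpow (by positivity) _ (by linarith)
      have : (‖ξ - η‖ / 2) ^ 2 ≤ ‖ξ‖ ^ 2 := by gcongr
      nlinarith [sq_nonneg μ]
    have h3 : (1 / 2) ^ (p - 1) * ‖ξ - η‖ ^ p = (‖ξ - η‖ / 2) ^ (p - 2) / 2 * ‖ξ - η‖ ^ 2 := by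
      rcases (norm_nonneg (ξ - η)).eq_or_lt with h | h
      · rw [← h, Real.zero_rpow (by linarith)]; simp
      · rw [show ‖ξ - η‖ / 2 = (1 / 2) * ‖ξ - η‖ by ring, Real.mul_rpow (by norm_num) h.le,
          show p - 1 = (p - 2) + 1 by ring, Real.rpow_add_one (by norm_num),
          show ‖ξ - η‖ ^ p = ‖ξ - η‖ ^ (p - 2) * ‖ξ - η‖ ^ 2 by
            rw [← Real.rpow_natCast, ← Real.rpow_add h]; congr 1; norm_num]
        ring
    rw [h3]
    have : (‖ξ - η‖ / 2) ^ (p - 2) / 2 * ‖ξ - η‖ ^ 2 ≤ (α + β) / 2 * ‖ξ - η‖ ^ 2 := by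
      gcongr; linarith
    linarith
  rcases le_total ‖η‖ ‖ξ‖ with h | h
  · exact main ξ η h
  · have := main η ξ h
    rw [norm_sub_rev, ← neg_sub ξ η, inner_neg_right, ← inner_neg_left, neg_sub] at this
    exact this

/-- Strong monotonicity of `ξ ↦ (μ² + |ξ|²)^{(p-2)/2} ξ` for `1 < p < 2`. -/
lemma inner_flux_sub_ge_sub {p μ : ℝ} (hp : 1 < p) (hp2 : p < 2) (hμ : 0 < μ) (ξ η : H) :
    (p - 1) * (μ ^ 2 + max ‖ξ‖ ‖η‖ ^ 2) ^ ((p - 2) / 2) * ‖ξ - η‖ ^ 2 ≤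
      inner ℝ ((μ ^ 2 + ‖ξ‖ ^ 2) ^ ((p - 2) / 2) • ξ - (μ ^ 2 + ‖η‖ ^ 2) ^ ((p - 2) / 2) • η)
        (ξ - η) := by
  have main : ∀ ξ η : H, ‖η‖ ≤ ‖ξ‖ →
      (p - 1) * (μ ^ 2 + max ‖ξ‖ ‖η‖ ^ 2) ^ ((p - 2) / 2) * ‖ξ - η‖ ^ 2 ≤
      inner ℝ ((μ ^ 2 + ‖ξ‖ ^ 2) ^ ((p - 2) / 2) • ξ - (μ ^ 2 + ‖η‖ ^ 2) ^ ((p - 2) / 2) • η)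
        (ξ - η) := by
    intro ξ η h
    rw [max_eq_left h, inner_smul_sub_smul]
    set α := (μ ^ 2 + ‖ξ‖ ^ 2) ^ ((p - 2) / 2) with hα
    set β := (μ ^ 2 + ‖η‖ ^ 2) ^ ((p - 2) / 2) with hβ
    have hα0 : 0 < α := by positivity
    have hβ0 : 0 < β := by positivity
    set x := ‖ξ‖
    set y := ‖η‖
    have hy : 0 ≤ y := norm_nonneg η
    have hαβ : α ≤ β := by
      apply Real.rpow_le_rpow_of_nonpos (by positivity) _ (by linarith)
      gcongr
    -- The one-dimensional estimate: β ≤ α (x/y)^(2-p), hence βy ≤ α x^(2-p) y^(p-1), and weighted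
    -- AM-GM bounds the product by (2-p)x + (p-1)y.
    have hscal : (p - 1) * α * (x - y) ≤ α * x - β * y := by
      rcases hy.eq_or_lt with h0 | h0
      · rw [← h0]
        have : 0 ≤ α * x := by positivity
        nlinarith
      have hx : 0 < x := h0.trans_le h
      have hr : β ≤ α * (x / y) ^ (2 - p) := by
        have e1 : (x / y) ^ (2 - p) = ((x / y) ^ 2) ^ ((2 - p) / 2) := by
          rw [← Real.rpow_natCast, ← Real.rpow_mul (by positivity)]
          congr 1; push_cast; ring
        have e2 : (μ ^ 2 + x ^ 2) / (μ ^ 2 + y ^ 2) ≤ (x / y) ^ 2 := by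
          rw [div_pow, div_le_div_iff₀ (by positivity) (by positivity)]
          have : y ^ 2 ≤ x ^ 2 := by gcongr
          nlinarith [sq_nonneg μ]
        have e3 : β = α * ((μ ^ 2 + x ^ 2) / (μ ^ 2 + y ^ 2)) ^ ((2 - p) / 2) := by
          rw [hα, hβ, Real.div_rpow (by positivity) (by positivity),
            show (p - 2) / 2 = -((2 - p) / 2) by ring, Real.rpow_neg (by positivity),
            Real.rpow_neg (by positivity)]
          field_simp
        rw [e3, e1]
        gcongr
      have hag := Real.geom_mean_le_arith_mean2_weighted (w₁ := 2 - p) (w₂ := p - 1)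
        (by linarith) (by linarith) hx.le hy (by ring)
      have e4 : (x / y) ^ (2 - p) * y = x ^ (2 - p) * y ^ (p - 1) := by
        rw [Real.div_rpow hx.le hy, show p - 1 = 1 - (2 - p) by ring,
          Real.rpow_sub h0 1 (2 - p), Real.rpow_one]
        ring
      have e5 : β * y ≤ α * ((2 - p) * x + (p - 1) * y) := by
        calc β * y ≤ α * (x / y) ^ (2 - p) * y := by gcongr
          _ = α * (x ^ (2 - p) * y ^ (p - 1)) := by rw [mul_assoc, e4]
          _ ≤ _ := by gcongr
      linarith
    -- Reduction to the scalar case: with |ξ - η| replaced by x - y the identity equals (αx - βy)(x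
    -- - y), and the excess has the coefficient (α+β)/2 - (p-1)α ≥ 0.
    have hd : (x - y) ^ 2 ≤ ‖ξ - η‖ ^ 2 := by
      have := norm_sub_norm_le ξ η
      have h0 : 0 ≤ x - y := by linarith
      gcongr
    have hc : 0 ≤ (α + β) / 2 - (p - 1) * α := by nlinarith
    have h1 : (p - 1) * α * (x - y) * (x - y) ≤ (α * x - β * y) * (x - y) := by
      gcongr
    have h2 := mul_le_mul_of_nonneg_left hd hc
    nlinarith
  rcases le_total ‖η‖ ‖ξ‖ with h | h
  · exact main ξ η h
  · have := main η ξ h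
    rw [norm_sub_rev, ← neg_sub ξ η, inner_neg_right, ← inner_neg_left, neg_sub, max_comm] at this
    exact this

lemma norm_smul_flux_le {p μ : ℝ} (hμ : 0 < μ) (ξ : H) :
    ‖(μ ^ 2 + ‖ξ‖ ^ 2) ^ ((p - 2) / 2) • ξ‖ ≤ √(μ ^ 2 + ‖ξ‖ ^ 2) ^ (p - 1) := by
  have hs : 0 < √(μ ^ 2 + ‖ξ‖ ^ 2) := by positivity
  have h1 : (μ ^ 2 + ‖ξ‖ ^ 2) ^ ((p - 2) / 2) = √(μ ^ 2 + ‖ξ‖ ^ 2) ^ (p - 2) := by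
    rw [Real.sqrt_eq_rpow, ← Real.rpow_mul (by positivity)]; congr 1; ring
  rw [norm_smul, Real.norm_of_nonneg (by positivity), h1, show p - 1 = (p - 2) + 1 by ring,
    Real.rpow_add_one hs.ne']
  gcongr
  exact Real.le_sqrt_of_sq_le (by nlinarith [sq_nonneg μ])

/-- With X, Y the fluxes of ξ, η, use βX - αY = β(X - Y) + (β - α)Y. The error involves only the
flux of η, so that in the end only the energy of Dv appears. -/
lemma inner_flux_diff_ge {p μ C₀ A α β : ℝ} (hμ : 0 < μ) {ξ η : H} (hβ : C₀ ≤ β)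
    (hA : |α - β| ≤ A)
    (hmon : 0 ≤ inner ℝ ((μ ^ 2 + ‖ξ‖ ^ 2) ^ ((p - 2) / 2) • ξ
      - (μ ^ 2 + ‖η‖ ^ 2) ^ ((p - 2) / 2) • η) (ξ - η)) :
    C₀ * inner ℝ ((μ ^ 2 + ‖ξ‖ ^ 2) ^ ((p - 2) / 2) • ξ
      - (μ ^ 2 + ‖η‖ ^ 2) ^ ((p - 2) / 2) • η) (ξ - η)
      - A * √(μ ^ 2 + ‖η‖ ^ 2) ^ (p - 1) * ‖ξ - η‖ ≤
    inner ℝ (β • ((μ ^ 2 + ‖ξ‖ ^ 2) ^ ((p - 2) / 2) • ξ)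
      - α • ((μ ^ 2 + ‖η‖ ^ 2) ^ ((p - 2) / 2) • η)) (ξ - η) := by
  have hV := norm_smul_flux_le (p := p) hμ η
  set X := (μ ^ 2 + ‖ξ‖ ^ 2) ^ ((p - 2) / 2) • ξ
  set Y := (μ ^ 2 + ‖η‖ ^ 2) ^ ((p - 2) / 2) • η
  have h1 : inner ℝ (β • X - α • Y) (ξ - η)
      = β * inner ℝ (X - Y) (ξ - η) + (β - α) * inner ℝ Y (ξ - η) := by
    simp only [inner_sub_left, real_inner_smul_left]; ring
  have h2 : |(β - α) * inner ℝ Y (ξ - η)| ≤ A * √(μ ^ 2 + ‖η‖ ^ 2) ^ (p - 1) * ‖ξ - η‖ := by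
    rw [abs_mul, abs_sub_comm, mul_assoc]
    have : |inner ℝ Y (ξ - η)| ≤ √(μ ^ 2 + ‖η‖ ^ 2) ^ (p - 1) * ‖ξ - η‖ :=
      (abs_real_inner_le_norm _ _).trans (by gcongr)
    have hA0 := (abs_nonneg _).trans hA
    gcongr
  have h3 := neg_abs_le ((β - α) * inner ℝ Y (ξ - η))
  have h4 := mul_le_mul_of_nonneg_right hβ hmon
  linarith

/-- Pointwise control of `|ξ - η|^p` by the monotone quantity, for `p ≥ 2`. -/
lemma norm_sub_rpow_le {p μ C₀ A α β : ℝ} (hp : 2 ≤ p) (hμ : 0 < μ) (hC₀ : 0 < C₀) (hA0 : 0 < A)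
    {ξ η : H} (hβ : C₀ ≤ β) (hA : |α - β| ≤ A) :
    ‖ξ - η‖ ^ p ≤ 2 ^ p / C₀ *
      inner ℝ (β • ((μ ^ 2 + ‖ξ‖ ^ 2) ^ ((p - 2) / 2) • ξ)
        - α • ((μ ^ 2 + ‖η‖ ^ 2) ^ ((p - 2) / 2) • η)) (ξ - η)
      + (2 ^ p / C₀) ^ (p / (p - 1)) * A ^ (p / (p - 1)) * (μ ^ 2 + ‖η‖ ^ 2) ^ (p / 2) := by
  have hm := inner_flux_sub_ge (μ := μ) hp ξ η
  have hF := inner_flux_diff_ge (p := p) hμ hβ hA (le_trans (by positivity) hm)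
  set M := inner ℝ ((μ ^ 2 + ‖ξ‖ ^ 2) ^ ((p - 2) / 2) • ξ
      - (μ ^ 2 + ‖η‖ ^ 2) ^ ((p - 2) / 2) • η) (ξ - η)
  set F := inner ℝ (β • ((μ ^ 2 + ‖ξ‖ ^ 2) ^ ((p - 2) / 2) • ξ)
      - α • ((μ ^ 2 + ‖η‖ ^ 2) ^ ((p - 2) / 2) • η)) (ξ - η)
  have hs : 0 < √(μ ^ 2 + ‖η‖ ^ 2) := by positivity
  have hsp : (μ ^ 2 + ‖η‖ ^ 2) ^ (p / 2) = √(μ ^ 2 + ‖η‖ ^ 2) ^ p := by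
    rw [Real.sqrt_eq_rpow, ← Real.rpow_mul (by positivity)]; congr 1; ring
  rw [hsp]
  set s := √(μ ^ 2 + ‖η‖ ^ 2)
  have hd : 0 ≤ ‖ξ - η‖ := norm_nonneg _
  set d := ‖ξ - η‖
  have h2 : (2 : ℝ) ^ p = 2 * 2 ^ (p - 1) := by
    rw [show p = (p - 1) + 1 by ring, Real.rpow_add_one (by norm_num)]; ring_nf
  have h3 : ((1 : ℝ) / 2) ^ (p - 1) * 2 ^ (p - 1) = 1 := by
    rw [← Real.mul_rpow (by norm_num) (by norm_num)]; norm_num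
  -- Division by s^p leaves an inequality in z = d/s alone. The factor 2^p/C₀ turns the monotonicity
  -- bound C₀ 2^(1-p) d^p into the 2 d^p required for absorption.
  have key := rpow_le_absorb (p := p) (z := d / s) (B := 2 ^ p / C₀ * A) (by linarith)
    (by positivity) (by positivity)
  rw [Real.mul_rpow (by positivity) hA0.le] at key
  have key2 := mul_le_mul_of_nonneg_right key (by positivity : 0 ≤ s ^ p)
  have e1 : (d / s) ^ p * s ^ p = d ^ p := by
    rw [← Real.mul_rpow (by positivity) hs.le, div_mul_cancel₀ _ hs.ne']
  have e2 : s ^ p = s ^ (p - 1) * s := by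
    rw [← Real.rpow_add_one hs.ne']; congr 1; ring
  have e3 : d / s * s ^ p = d * s ^ (p - 1) := by
    rw [e2]; field_simp
  have h5 : C₀ * ((1 / 2) ^ (p - 1) * d ^ p) - A * s ^ (p - 1) * d ≤ F := by
    have := mul_le_mul_of_nonneg_left hm hC₀.le
    linarith
  have h6 : 2 ^ p / C₀ * (C₀ * ((1 / 2) ^ (p - 1) * d ^ p) - A * s ^ (p - 1) * d)
      ≤ 2 ^ p / C₀ * F := by gcongr
  have h7 : 2 ^ p / C₀ * (C₀ * ((1 / 2) ^ (p - 1) * d ^ p) - A * s ^ (p - 1) * d)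
      = 2 * d ^ p - 2 ^ p / C₀ * A * (d * s ^ (p - 1)) := by
    have : 2 ^ p / C₀ * (C₀ * ((1 / 2) ^ (p - 1) * d ^ p)) = 2 * d ^ p := by
      rw [h2]; field_simp; linear_combination (d ^ p) * h3
    linear_combination this
  have h8 : (2 * ((d / s) ^ p - 2 ^ p / C₀ * A * (d / s) / 2)
      + (2 ^ p / C₀) ^ (p / (p - 1)) * A ^ (p / (p - 1))) * s ^ p
      = 2 * d ^ p - 2 ^ p / C₀ * A * (d * s ^ (p - 1))
        + (2 ^ p / C₀) ^ (p / (p - 1)) * A ^ (p / (p - 1)) * s ^ p := by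
    rw [← e1, ← e3]; ring
  rw [e1, h8] at key2
  linarith

/-- Pointwise control of `|ξ - η|^p` by the monotone quantity, for `1 < p < 2`. -/
lemma norm_sub_rpow_le_sub {p C₀ : ℝ} (hp : 1 < p) (hp2 : p < 2) (hC₀ : 0 < C₀) :
    ∃ K : ℝ, 0 < K ∧ ∀ A : ℝ, 0 < A → ∃ Λ : ℝ, 0 ≤ Λ ∧ ∀ (N k : ℕ) (μ α β : ℝ) (ξ η : GradSpace k N), 0 < μ →
      C₀ ≤ β → |α - β| ≤ A →
      ‖ξ - η‖ ^ p ≤ Λ *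
      inner ℝ (β • ((μ ^ 2 + ‖ξ‖ ^ 2) ^ ((p - 2) / 2) • ξ)
        - α • ((μ ^ 2 + ‖η‖ ^ 2) ^ ((p - 2) / 2) • η)) (ξ - η)
      + K * (A ^ p + A ^ (p / (p - 1))) * (μ ^ 2 + ‖η‖ ^ 2) ^ (p / 2) := by
  set c : ℝ := C₀ * ((p - 1) * 2 ^ (p - 2)) with hc
  have hp1 : 0 < p - 1 := by linarith
  have hc0 : 0 < c := by positivity
  -- K is fixed before A. Only Λ depends on A; it blows up as A tends to 0, which is harmless since
  -- it multiplies a nonpositive integral.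
  refine ⟨4 * ((2 / c) ^ p + (2 / c) ^ (p / (p - 1))), by positivity, fun A hA0 =>
    ⟨2 * (1 + (2 / c * A) ^ (p - 2)) / c, by positivity, ?_⟩⟩
  intro N k μ α β ξ η hμ hβ hA
  have hm := inner_flux_sub_ge_sub hp hp2 hμ ξ η
  have hF := inner_flux_diff_ge (p := p) hμ hβ hA (le_trans (by positivity) hm)
  set M := inner ℝ ((μ ^ 2 + ‖ξ‖ ^ 2) ^ ((p - 2) / 2) • ξ
      - (μ ^ 2 + ‖η‖ ^ 2) ^ ((p - 2) / 2) • η) (ξ - η)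
  set F := inner ℝ (β • ((μ ^ 2 + ‖ξ‖ ^ 2) ^ ((p - 2) / 2) • ξ)
      - α • ((μ ^ 2 + ‖η‖ ^ 2) ^ ((p - 2) / 2) • η)) (ξ - η)
  have hs : 0 < √(μ ^ 2 + ‖η‖ ^ 2) := by positivity
  have hs2 : √(μ ^ 2 + ‖η‖ ^ 2) ^ 2 = μ ^ 2 + ‖η‖ ^ 2 := Real.sq_sqrt (by positivity)
  have hsp : (μ ^ 2 + ‖η‖ ^ 2) ^ (p / 2) = √(μ ^ 2 + ‖η‖ ^ 2) ^ p := by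
    rw [Real.sqrt_eq_rpow, ← Real.rpow_mul (by positivity)]; congr 1; ring
  rw [hsp]
  set s := √(μ ^ 2 + ‖η‖ ^ 2)
  have hd : 0 ≤ ‖ξ - η‖ := norm_nonneg _
  -- The degenerate weight is thus comparable to max(s, d)^(p-2): the regime d ≤ s yields the lower
  -- bound z², the regime d ≥ s yields z^p.
  have hmax : μ ^ 2 + max ‖ξ‖ ‖η‖ ^ 2 ≤ 2 * (s ^ 2 + ‖ξ - η‖ ^ 2) := by
    rw [hs2]
    have h1 : ‖ξ‖ ≤ ‖η‖ + ‖ξ - η‖ := by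
      have := norm_add_le η (ξ - η); rwa [add_sub_cancel] at this
    have h2 : max ‖ξ‖ ‖η‖ ≤ ‖η‖ + ‖ξ - η‖ := max_le h1 (by linarith)
    have h3 : max ‖ξ‖ ‖η‖ ^ 2 ≤ (‖η‖ + ‖ξ - η‖) ^ 2 := by gcongr
    nlinarith [sq_nonneg (‖η‖ - ‖ξ - η‖), sq_nonneg μ]
  set d := ‖ξ - η‖
  have hD0 : 0 < μ ^ 2 + max ‖ξ‖ ‖η‖ ^ 2 := by positivity
  set D := μ ^ 2 + max ‖ξ‖ ‖η‖ ^ 2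
  have hpow : ∀ x : ℝ, 0 < x → D ≤ 4 * x ^ 2 → 2 ^ (p - 2) * x ^ (p - 2) ≤ D ^ ((p - 2) / 2) := by
    intro x hx h
    have : 2 ^ (p - 2) * x ^ (p - 2) = (4 * x ^ 2) ^ ((p - 2) / 2) := by
      rw [← Real.mul_rpow (by norm_num) hx.le, show 4 * x ^ 2 = (2 * x) ^ 2 by ring,
        ← Real.rpow_natCast, ← Real.rpow_mul (by positivity)]
      congr 1; push_cast; ring
    rw [this]
    exact Real.rpow_le_rpow_of_nonpos hD0 h (by linarith)
  have e1 : (d / s) ^ p * s ^ p = d ^ p := by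
    rw [← Real.mul_rpow (by positivity) hs.le, div_mul_cancel₀ _ hs.ne']
  have e2 : s ^ p = s ^ (p - 1) * s := by
    rw [← Real.rpow_add_one hs.ne']; congr 1; ring
  have e2' : s ^ p = s ^ (p - 2) * s ^ 2 := by
    rw [← Real.rpow_natCast s 2, ← Real.rpow_add hs]; congr 1; norm_num
  have e3 : d / s * s ^ p = d * s ^ (p - 1) := by
    rw [e2]; field_simp
  have hsp0 : 0 < s ^ p := by positivity
  have hMc : ∀ y : ℝ, (p - 1) * 2 ^ (p - 2) * (y * s ^ p) ≤ M → y ≤ C₀ * M / (c * s ^ p) := by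
    intro y hy
    rw [le_div_iff₀ (by positivity), hc]
    have := mul_le_mul_of_nonneg_left hy hC₀.le
    linarith
  have key := rpow_le_absorb_sub (p := p) (z := d / s) (B := 2 / c * A)
    (m := C₀ * M / (c * s ^ p)) hp hp2 (by positivity) (by positivity)
    (by
      intro hz
      rw [div_le_one hs] at hz
      apply hMc
      refine le_trans ?_ hm
      have h1 := hpow s hs (by nlinarith)
      rw [e2', show (p - 1) * 2 ^ (p - 2) * ((d / s) ^ 2 * (s ^ (p - 2) * s ^ 2))
        = (p - 1) * (2 ^ (p - 2) * s ^ (p - 2)) * d ^ 2 by field_simp]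
      gcongr)
    (by
      intro hz
      rw [one_le_div hs] at hz
      have hd0 : 0 < d := hs.trans_le hz
      apply hMc
      refine le_trans ?_ hm
      have h1 := hpow d hd0 (by nlinarith)
      have e4 : d ^ p = d ^ (p - 2) * d ^ 2 := by
        rw [← Real.rpow_natCast d 2, ← Real.rpow_add hd0]; congr 1; norm_num
      rw [e1, e4, show (p - 1) * 2 ^ (p - 2) * (d ^ (p - 2) * d ^ 2)
        = (p - 1) * (2 ^ (p - 2) * d ^ (p - 2)) * d ^ 2 by ring]
      gcongr)
  have key2 := mul_le_mul_of_nonneg_right key hsp0.le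
  rw [e1, add_mul] at key2
  refine key2.trans ?_
  have hB : (2 / c * A) ^ p + (2 / c * A) ^ (p / (p - 1))
      ≤ ((2 / c) ^ p + (2 / c) ^ (p / (p - 1))) * (A ^ p + A ^ (p / (p - 1))) := by
    rw [Real.mul_rpow (by positivity) hA0.le, Real.mul_rpow (by positivity) hA0.le]
    have : 0 ≤ (2 / c) ^ p * A ^ (p / (p - 1)) := by positivity
    have : 0 ≤ (2 / c) ^ (p / (p - 1)) * A ^ p := by positivity
    nlinarith
  have h9 : 2 * (1 + (2 / c * A) ^ (p - 2)) * (C₀ * M / (c * s ^ p) - 2 / c * A * (d / s) / 2) * s ^ p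
      = 2 * (1 + (2 / c * A) ^ (p - 2)) / c * (C₀ * M - A * s ^ (p - 1) * d) := by
    have : (C₀ * M / (c * s ^ p) - 2 / c * A * (d / s) / 2) * s ^ p
        = (C₀ * M - A * (d / s * s ^ p)) / c := by
      field_simp
    rw [mul_assoc, this, e3]; ring
  rw [h9]
  have h10 : 4 * ((2 / c * A) ^ p + (2 / c * A) ^ (p / (p - 1))) * s ^ p ≤
      4 * ((2 / c) ^ p + (2 / c) ^ (p / (p - 1))) * (A ^ p + A ^ (p / (p - 1))) * s ^ p := by
    rw [mul_assoc 4 ((2 / c) ^ p + (2 / c) ^ (p / (p - 1)))]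
    gcongr
  have h11 : 2 * (1 + (2 / c * A) ^ (p - 2)) / c * (C₀ * M - A * s ^ (p - 1) * d)
      ≤ 2 * (1 + (2 / c * A) ^ (p - 2)) / c * F := by gcongr
  linarith

end

end ParabolicSystem

/-! ### The time kernel and the antisymmetry argument -/

namespace ParabolicSystem
noncomputable section

lemma hasDerivAt_max_zero_sq (x : ℝ) :
    HasDerivAt (fun y : ℝ => max 0 y ^ 2) (2 * max 0 x) x := by
  rcases lt_trichotomy x 0 with hx | rfl | hx
  · rw [max_eq_left hx.le, mul_zero]
    refine (hasDerivAt_const x (0 : ℝ)).congr_of_eventuallyEq ?_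
    filter_upwards [Iio_mem_nhds hx] with y hy
    simp [max_eq_left (le_of_lt (mem_Iio.1 hy))]
  · have : (fun y : ℝ => max 0 y ^ 2) =O[𝓝 0] fun y => ‖y - 0‖ ^ 2 := by
      refine Asymptotics.IsBigO.of_bound 1 (Eventually.of_forall fun y => ?_)
      simp only [sub_zero, Real.norm_eq_abs, abs_pow, one_mul, abs_abs]
      refine pow_le_pow_left₀ (abs_nonneg _) ?_ 2
      rw [abs_of_nonneg (le_max_left 0 y)]
      exact max_le (abs_nonneg y) (le_abs_self y)
    have h := (this.hasFDerivAt one_lt_two).hasDerivAt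
    simpa using h
  · rw [max_eq_right hx.le]
    refine HasDerivAt.congr_of_eventuallyEq (f := fun y : ℝ => y ^ 2) ?_ ?_
    · simpa using hasDerivAt_pow 2 x
    filter_upwards [Ioi_mem_nhds hx] with y hy
    simp [max_eq_right (le_of_lt (mem_Ioi.1 hy))]

/-- An even, compactly supported `C¹` kernel concentrating at the origin as `h → 0`. -/
def timeKernel (h r : ℝ) : ℝ := max 0 (1 - (r / h) ^ 2) ^ 2 / h

/-- The derivative of `timeKernel`. -/
def timeKernelDeriv (h r : ℝ) : ℝ := -(4 * (r / h) * max 0 (1 - (r / h) ^ 2)) / h ^ 2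

lemma hasDerivAt_timeKernel (h r : ℝ) : HasDerivAt (timeKernel h) (timeKernelDeriv h r) r := by
  have h1 : HasDerivAt (fun r : ℝ => 1 - (r / h) ^ 2) (-(2 * (r / h) * (1 / h))) r := by
    have := ((hasDerivAt_id r).div_const h).pow 2
    simpa using this.const_sub 1
  have h2 := ((hasDerivAt_max_zero_sq (1 - (r / h) ^ 2)).comp r h1).div_const h
  unfold timeKernelDeriv
  convert! h2 using 1
  field_simp
  ring

lemma continuous_timeKernel (h : ℝ) : Continuous (timeKernel h) := by
  unfold timeKernel; fun_prop

lemma continuous_timeKernelDeriv (h : ℝ) : Continuous (timeKernelDeriv h) := by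
  unfold timeKernelDeriv; fun_prop

lemma timeKernel_nonneg {h : ℝ} (hh : 0 < h) (r : ℝ) : 0 ≤ timeKernel h r := by
  unfold timeKernel; positivity

lemma timeKernel_le {h : ℝ} (hh : 0 < h) (r : ℝ) : timeKernel h r ≤ 1 / h := by
  unfold timeKernel
  gcongr
  apply pow_le_one₀ (le_max_left _ _)
  exact max_le zero_le_one (by linarith [sq_nonneg (r / h)])

lemma max_one_sub_sq_eq_zero {h r : ℝ} (hh : 0 < h) (hr : h ≤ |r|) :
    max 0 (1 - (r / h) ^ 2) = 0 := by
  apply max_eq_left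
  have : 1 ≤ |r / h| := by rw [abs_div, abs_of_pos hh, one_le_div hh]; exact hr
  have := one_le_pow₀ this (n := 2)
  rw [sq_abs] at this
  linarith

lemma timeKernel_eq_zero {h r : ℝ} (hh : 0 < h) (hr : h ≤ |r|) : timeKernel h r = 0 := by
  simp [timeKernel, max_one_sub_sq_eq_zero hh hr]

lemma timeKernelDeriv_eq_zero {h r : ℝ} (hh : 0 < h) (hr : h ≤ |r|) :
    timeKernelDeriv h r = 0 := by
  simp [timeKernelDeriv, max_one_sub_sq_eq_zero hh hr]

lemma timeKernelDeriv_neg (h r : ℝ) : timeKernelDeriv h (-r) = -timeKernelDeriv h r := by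
  simp only [timeKernelDeriv, neg_div, neg_sq]; ring

lemma timeKernelDeriv_nonpos {h r : ℝ} (hh : 0 < h) (hr : 0 ≤ r) : timeKernelDeriv h r ≤ 0 := by
  unfold timeKernelDeriv
  rw [neg_div, neg_nonpos]
  positivity

lemma abs_timeKernelDeriv_le {h : ℝ} (hh : 0 < h) (r : ℝ) :
    |timeKernelDeriv h r| ≤ 4 / h ^ 2 := by
  rcases le_total h |r| with hr | hr
  · rw [timeKernelDeriv_eq_zero hh hr, abs_zero]; positivity
  · unfold timeKernelDeriv
    rw [abs_div, abs_neg, abs_mul, abs_mul, abs_of_pos (by positivity : 0 < h ^ 2),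
      abs_of_pos (by norm_num : (0 : ℝ) < 4)]
    gcongr
    have h1 : |r / h| ≤ 1 := by rw [abs_div, abs_of_pos hh, div_le_one hh]; exact hr
    have h2 : |max 0 (1 - (r / h) ^ 2)| ≤ 1 := by
      rw [abs_of_nonneg (le_max_left _ _)]
      exact max_le zero_le_one (by linarith [sq_nonneg (r / h)])
    have := mul_le_one₀ h1 (abs_nonneg _) h2
    linarith

lemma hasCompactSupport_timeKernel {h : ℝ} (hh : 0 < h) : HasCompactSupport (timeKernel h) := by
  refine HasCompactSupport.intro (isCompact_Icc (a := -h) (b := h)) fun r hr => ?_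
  apply timeKernel_eq_zero hh
  by_contra hlt
  exact hr (abs_le.1 (not_le.1 hlt).le)

/-- The kernel is not normalised. By scaling its mass is independent of h, and its positivity is all
that is needed later. -/
lemma integral_timeKernel {h : ℝ} (hh : 0 < h) : ∫ r, timeKernel h r = ∫ r, timeKernel 1 r := by
  have h1 : ∀ r, timeKernel h r = h⁻¹ * timeKernel 1 (r / h) := by
    intro r; simp only [timeKernel, div_one]; ring
  simp_rw [h1]
  rw [integral_const_mul, Measure.integral_comp_div, abs_of_pos hh, smul_eq_mul,
    inv_mul_cancel_left₀ hh.ne']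

lemma integral_timeKernel_one_pos : 0 < ∫ r, timeKernel 1 r := by
  have h0 : timeKernel 1 0 ≠ 0 := by simp [timeKernel]
  exact (continuous_timeKernel 1).integral_pos_of_hasCompactSupport_nonneg_nonzero
    (hasCompactSupport_timeKernel one_pos) (timeKernel_nonneg one_pos) h0

lemma integrable_timeKernel {h : ℝ} (hh : 0 < h) : Integrable (timeKernel h) :=
  (continuous_timeKernel h).integrable_of_hasCompactSupport (μ := volume)
    (hasCompactSupport_timeKernel hh)

lemma intervalIntegral_le_of_le {G : ℝ → ℝ} (hG : Continuous G) {a b C : ℝ} (hab : a ≤ b)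
    (h : ∀ x ∈ Icc a b, G x ≤ C) : ∫ x in a..b, G x ≤ C * (b - a) := by
  have := intervalIntegral.integral_mono_on hab (hG.intervalIntegrable (μ := volume) a b)
    (intervalIntegrable_const (μ := volume)) h
  rw [intervalIntegral.integral_const, smul_eq_mul] at this
  linarith

lemma integral_integral_antisymm {g : ℝ → ℝ → ℝ} (hg : Continuous (Function.uncurry g))
    (hanti : ∀ t s, g t s = -g s t) (a b : ℝ) :
    ∫ s in a..b, ∫ t in a..b, g t s = 0 := by
  have hswap : ∫ s in a..b, ∫ t in a..b, g t s = ∫ t in a..b, ∫ s in a..b, g t s := by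
    apply intervalIntegral_intervalIntegral_swap
    refine ((hg.comp continuous_swap).continuousOn.integrableOn_compact
      (isCompact_uIcc.prod isCompact_uIcc)).mono_set
        (prod_mono uIoc_subset_uIcc uIoc_subset_uIcc)
  have hneg : ∫ t in a..b, ∫ s in a..b, g t s = -∫ s in a..b, ∫ t in a..b, g t s := by
    rw [← intervalIntegral.integral_neg]
    congr 1; ext t
    rw [← intervalIntegral.integral_neg]
    congr 1; ext s
    exact hanti t s
  linarith

/-- The central square contributes zero by antisymmetry. In each of the two strips of width h in t,
the integrand can be positive only on a square of area h², where it is at most K. -/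
lemma integral_integral_le_of_antisymm {g : ℝ → ℝ → ℝ} (hg : Continuous (Function.uncurry g))
    (hanti : ∀ t s, g t s = -g s t) {h T K : ℝ} (hh : 0 < h) (hT : 3 * h ≤ T)
    (h1 : ∀ t ∈ Icc 0 h, ∀ s ∈ Icc h (2 * h), g t s ≤ K)
    (h2 : ∀ t ∈ Icc 0 h, ∀ s ∈ Icc (2 * h) (T - h), g t s ≤ 0)
    (h3 : ∀ t ∈ Icc (T - h) T, ∀ s ∈ Icc (T - 2 * h) (T - h), g t s ≤ K)
    (h4 : ∀ t ∈ Icc (T - h) T, ∀ s ∈ Icc h (T - 2 * h), g t s ≤ 0) :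
    ∫ s in h..(T - h), ∫ t in (0 : ℝ)..T, g t s ≤ 2 * K * h ^ 2 := by
  have hc : ∀ s, Continuous fun t => g t s := fun s =>
    hg.comp (continuous_id.prodMk continuous_const)
  have hI : ∀ a b : ℝ, Continuous fun s => ∫ t in a..b, g t s := fun a b =>
    intervalIntegral.continuous_parametric_intervalIntegral_of_continuous'
      (f := fun s t => g t s) (hg.comp continuous_swap) a b
  have hii : ∀ a b c d : ℝ, IntervalIntegrable (fun s => ∫ t in a..b, g t s) volume c d :=
    fun a b c d => (hI a b).intervalIntegrable c d
  have hsplit : ∀ s, ∫ t in (0 : ℝ)..T, g t s =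
      (∫ t in (0 : ℝ)..h, g t s) + (∫ t in h..(T - h), g t s) + ∫ t in (T - h)..T, g t s := by
    intro s
    rw [intervalIntegral.integral_add_adjacent_intervals ((hc s).intervalIntegrable _ _)
      ((hc s).intervalIntegrable _ _), intervalIntegral.integral_add_adjacent_intervals
      ((hc s).intervalIntegrable _ _) ((hc s).intervalIntegrable _ _)]
  simp_rw [hsplit]
  rw [intervalIntegral.integral_add ((hii _ _ _ _).add (hii _ _ _ _)) (hii _ _ _ _),
    intervalIntegral.integral_add (hii _ _ _ _) (hii _ _ _ _),
    integral_integral_antisymm hg hanti]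
  have b1 : ∫ s in h..(T - h), ∫ t in (0 : ℝ)..h, g t s ≤ K * h ^ 2 := by
    rw [← intervalIntegral.integral_add_adjacent_intervals (hii 0 h h (2 * h))
      (hii 0 h (2 * h) (T - h))]
    have e1 := intervalIntegral_le_of_le (hI 0 h) (a := h) (b := 2 * h) (C := K * h)
      (by linarith) (fun s hs => by
        have := intervalIntegral_le_of_le (hc s) hh.le (fun t ht => h1 t ht s hs)
        linarith)
    have e2 := intervalIntegral_le_of_le (hI 0 h) (a := 2 * h) (b := T - h) (C := 0)
      (by linarith) (fun s hs => by
        have := intervalIntegral_le_of_le (hc s) hh.le (fun t ht => h2 t ht s hs)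
        linarith)
    nlinarith
  have b2 : ∫ s in h..(T - h), ∫ t in (T - h)..T, g t s ≤ K * h ^ 2 := by
    rw [← intervalIntegral.integral_add_adjacent_intervals (hii (T - h) T h (T - 2 * h))
      (hii (T - h) T (T - 2 * h) (T - h))]
    have e1 := intervalIntegral_le_of_le (hI (T - h) T) (a := T - 2 * h) (b := T - h) (C := K * h)
      (by linarith) (fun s hs => by
        have := intervalIntegral_le_of_le (hc s) (by linarith) (fun t ht => h3 t ht s hs)
        linarith)
    have e2 := intervalIntegral_le_of_le (hI (T - h) T) (a := h) (b := T - 2 * h) (C := 0)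
      (by linarith) (fun s hs => by
        have := intervalIntegral_le_of_le (hc s) (by linarith) (fun t ht => h4 t ht s hs)
        linarith)
    nlinarith
  linarith

/-- For a continuous curve in an inner product space starting at the origin, the mollified
time-derivative pairing is asymptotically nonpositive. -/
lemma exists_integral_inner_timeKernelDeriv_le {H : Type*} [NormedAddCommGroup H]
    [InnerProductSpace ℝ H] {u : ℝ → H} (hu : Continuous u) (hu0 : u 0 = 0) {T ε : ℝ}
    (hT : 0 < T) (hε : 0 < ε) :
    ∃ h₀ > 0, ∀ h, 0 < h → h < h₀ →
      ∫ s in h..(T - h), ∫ t in (0 : ℝ)..T, inner ℝ (u t) (u s) * timeKernelDeriv h (t - s)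
        ≤ ε := by
  have hcont : Continuous fun q : ℝ × ℝ => (inner ℝ (u q.1) (u q.2) : ℝ) := by fun_prop
  have c0 : ∀ᶠ q in 𝓝 ((0 : ℝ), (0 : ℝ)), |(inner ℝ (u q.1) (u q.2) : ℝ)| < ε / 8 := by
    have := hcont.abs.tendsto ((0 : ℝ), (0 : ℝ))
    refine this.eventually_lt_const ?_
    simp only [hu0, inner_zero_left, abs_zero]; linarith
  -- Since u(T) need not vanish, only a lower bound is available here; it suffices because the
  -- kernel derivative is nonpositive for t ≥ s.
  have cT : ∀ᶠ q in 𝓝 (T, T), -(ε / 8) < (inner ℝ (u q.1) (u q.2) : ℝ) := by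
    refine (hcont.tendsto (T, T)).eventually_const_lt ?_
    have : (0 : ℝ) ≤ inner ℝ (u T) (u T) := real_inner_self_nonneg
    simp only
    linarith
  obtain ⟨δ₁, hδ₁, H₁⟩ := Metric.eventually_nhds_iff.1 c0
  obtain ⟨δ₂, hδ₂, H₂⟩ := Metric.eventually_nhds_iff.1 cT
  refine ⟨min (min (δ₁ / 2) (δ₂ / 2)) (T / 3), by positivity, fun h hh hlt => ?_⟩
  have l1 : 2 * h < δ₁ := by
    have := hlt.trans_le ((min_le_left _ _).trans (min_le_left _ _)); linarith
  have l2 : 2 * h < δ₂ := by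
    have := hlt.trans_le ((min_le_left _ _).trans (min_le_right _ _)); linarith
  have l3 : 3 * h ≤ T := by
    have := hlt.trans_le (min_le_right _ _); linarith
  have hk := continuous_timeKernelDeriv h
  -- K combines the bound ε/8 with the size 4/h² of the kernel derivative, so that 2Kh² = ε.
  have hfin := integral_integral_le_of_antisymm
    (g := fun t s => inner ℝ (u t) (u s) * timeKernelDeriv h (t - s)) (h := h) (T := T)
    (K := ε / 8 * (4 / h ^ 2)) ?_ ?_ hh l3 ?_ ?_ ?_ ?_
  · refine hfin.trans (le_of_eq ?_)
    field_simp
    norm_num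
  · simp only [Function.uncurry_def]; fun_prop
  · intro t s
    rw [real_inner_comm, ← neg_sub t s, timeKernelDeriv_neg]; ring
  · intro t ht s hs
    have h1 : |(inner ℝ (u t) (u s) : ℝ)| < ε / 8 := by
      refine H₁ (y := (t, s)) ?_
      rw [Prod.dist_eq, max_lt_iff, Real.dist_eq, Real.dist_eq, abs_lt, abs_lt]
      constructor <;> constructor <;> linarith [ht.1, ht.2, hs.1, hs.2]
    refine (le_abs_self _).trans ?_
    rw [abs_mul]
    exact mul_le_mul h1.le (abs_timeKernelDeriv_le hh _) (abs_nonneg _) (by positivity)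
  · intro t ht s hs
    have : h ≤ |t - s| := by
      rw [abs_sub_comm]; refine le_trans ?_ (le_abs_self _); linarith [ht.2, hs.1]
    simp only [timeKernelDeriv_eq_zero hh this, mul_zero, le_refl]
  · intro t ht s hs
    have h1 : -(ε / 8) < (inner ℝ (u t) (u s) : ℝ) := by
      refine H₂ (y := (t, s)) ?_
      rw [Prod.dist_eq, max_lt_iff, Real.dist_eq, Real.dist_eq, abs_lt, abs_lt]
      constructor <;> constructor <;> linarith [ht.1, ht.2, hs.1, hs.2]
    have h2 := timeKernelDeriv_nonpos hh (r := t - s) (by linarith [ht.1, hs.2])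
    have h3 := abs_timeKernelDeriv_le hh (t - s)
    rw [abs_of_nonpos h2] at h3
    nlinarith
  · intro t ht s hs
    have : h ≤ |t - s| := by
      refine le_trans ?_ (le_abs_self _); linarith [ht.1, hs.2]
    simp only [timeKernelDeriv_eq_zero hh this, mul_zero, le_refl]

end
end ParabolicSystem

/-! ### Hölder pairings, translations and mollification in space-time -/

namespace ParabolicSystem
noncomputable section

section Hoelder
variable {α V : Type*} [MeasurableSpace α] [NormedAddCommGroup V] [InnerProductSpace ℝ V]
  {ν : Measure α} {p q : ℝ} {f g : α → V}

lemma integrable_inner_of_memLp (hpq : p.HolderConjugate q) (hf : MemLp f (ENNReal.ofReal p) ν)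
    (hg : MemLp g (ENNReal.ofReal q) ν) : Integrable (fun x => (inner ℝ (f x) (g x) : ℝ)) ν := by
  have := hpq.ennrealOfReal
  rw [← memLp_one_iff_integrable]
  refine MemLp.of_bilin (p := ENNReal.ofReal p) (q := ENNReal.ofReal q)
    (fun x y : V => (inner ℝ x y : ℝ)) 1 hf hg (hf.1.inner hg.1) (ae_of_all _ fun x => ?_)
  simpa using nnnorm_inner_le_nnnorm (𝕜 := ℝ) (f x) (g x)

lemma abs_integral_inner_le (hpq : p.HolderConjugate q) (hf : MemLp f (ENNReal.ofReal p) ν)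
    (hg : MemLp g (ENNReal.ofReal q) ν) :
    |∫ x, (inner ℝ (f x) (g x) : ℝ) ∂ν| ≤
      (eLpNorm f (ENNReal.ofReal p) ν).toReal * (eLpNorm g (ENNReal.ofReal q) ν).toReal := by
  have := hpq.ennrealOfReal
  have h1 : ‖∫ x, (inner ℝ (f x) (g x) : ℝ) ∂ν‖ₑ ≤
      eLpNorm f (ENNReal.ofReal p) ν * eLpNorm g (ENNReal.ofReal q) ν := by
    refine (enorm_integral_le_lintegral_enorm _).trans ?_
    rw [← eLpNorm_one_eq_lintegral_enorm]
    have := eLpNorm_le_eLpNorm_mul_eLpNorm_of_nnnorm (p := ENNReal.ofReal p)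
      (q := ENNReal.ofReal q) (r := 1) hf.1 hg.1
      (fun x y : V => (inner ℝ x y : ℝ)) 1 (ae_of_all _ fun x => by
        simpa using nnnorm_inner_le_nnnorm (𝕜 := ℝ) (f x) (g x))
    simpa using this
  have h2 := ENNReal.toReal_mono (ENNReal.mul_ne_top hf.2.ne hg.2.ne) h1
  rwa [ENNReal.toReal_mul, toReal_enorm, Real.norm_eq_abs] at h2

end Hoelder

section Translation
variable {X V : Type*} [TopologicalSpace X] [R1Space X] [MeasurableSpace X]
  [BorelSpace X] {ν : Measure X} [NormedAddCommGroup V]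

/-- Continuity in `L^p` of a continuous family of measure preserving changes of variables. -/
lemma tendsto_eLpNorm_comp_sub {ι : Type*} [TopologicalSpace ι] [IsLocallyFiniteMeasure ν]
    [ν.InnerRegularCompactLTTop] {p : ℝ≥0∞} (h1 : 1 ≤ p) (hp : p ≠ ⊤) {F : X → V}
    (hF : MemLp F p ν) (τ : ι → X → X) (hτ : Continuous (Function.uncurry τ))
    (hmp : ∀ r, MeasurePreserving (τ r) ν ν) (r₀ : ι) (hr₀ : τ r₀ = id) :
    Tendsto (fun r => eLpNorm (fun z => F (τ r z) - F z) p ν) (𝓝 r₀) (𝓝 0) := by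
  have : Fact (1 ≤ p) := ⟨h1⟩
  let g : C(ι, C(X, X)) := (ContinuousMap.mk (Function.uncurry τ) hτ).curry
  have hc : Continuous fun r => Lp.compMeasurePreserving (g r) (hmp r) (hF.toLp F) :=
    continuous_const.compMeasurePreservingLp g.continuous hmp hp
  have ht := hc.tendsto r₀
  rw [tendsto_iff_edist_tendsto_0] at ht
  refine ht.congr fun r => ?_
  rw [Lp.edist_def]
  refine eLpNorm_congr_ae ?_
  have e1 : ∀ r, (Lp.compMeasurePreserving (g r) (hmp r) (hF.toLp F) : X → V) =ᵐ[ν]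
      fun z => F (τ r z) := fun r =>
    (Lp.coeFn_compMeasurePreserving _ (hmp r)).trans
      ((hmp r).quasiMeasurePreserving.ae_eq_comp hF.coeFn_toLp)
  filter_upwards [e1 r, e1 r₀] with z h h'
  simp only [Pi.sub_apply, h, h', hr₀, id]

end Translation

section Mollify
variable {X V : Type*} [MeasurableSpace X] {ν : Measure X} [SFinite ν]

/-- Exchange of the two time variables. -/
def swapTime (y : ℝ × (X × ℝ)) : ℝ × (X × ℝ) := (y.2.2, (y.2.1, y.1))

lemma measurePreserving_swapTime :
    MeasurePreserving (swapTime (X := X)) ((volume : Measure ℝ).prod (ν.prod volume))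
      ((volume : Measure ℝ).prod (ν.prod volume)) := by
  have h1 := ((measurePreserving_prodAssoc (volume : Measure ℝ) ν (volume : Measure ℝ)).symm
    MeasurableEquiv.prodAssoc)
  have h2 := Measure.measurePreserving_swap (μ := (volume : Measure ℝ).prod ν)
    (ν := (volume : Measure ℝ))
  have h3 := (MeasurePreserving.id (volume : Measure ℝ)).prod
    (Measure.measurePreserving_swap (μ := (volume : Measure ℝ)) (ν := ν))
  exact h3.comp (h2.comp h1)

lemma measurePreserving_timeShift (r : ℝ) :
    MeasurePreserving (fun z : X × ℝ => (z.1, z.2 + r)) (ν.prod volume) (ν.prod volume) :=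
  (MeasurePreserving.id ν).prod (measurePreserving_add_right volume r)

lemma measurePreserving_shear :
    MeasurePreserving (fun y : ℝ × (X × ℝ) => (y.1, (y.2.1, y.2.2 + y.1)))
      ((volume : Measure ℝ).prod (ν.prod volume)) ((volume : Measure ℝ).prod (ν.prod volume)) := by
  refine (MeasurePreserving.id (volume : Measure ℝ)).skew_product
    (g := fun (s : ℝ) (z : X × ℝ) => (z.1, z.2 + s)) ?_ (ae_of_all _ fun s => ?_)
  · simp only [Function.uncurry_def]; fun_prop
  · exact (measurePreserving_timeShift s).map_eq

variable [NormedAddCommGroup V] [InnerProductSpace ℝ V] {p q : ℝ} {F G : X × ℝ → V} {T : ℝ}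

/-- Young's inequality bounds the integrand by |F(x,t)|^q + |G(x,s)|^p. The extra time variable of
each term costs only a factor T, as both functions vanish outside (0, T]. -/
lemma integrable_cross_inner (hpq : p.HolderConjugate q)
    (hF : MemLp F (ENNReal.ofReal q) (ν.prod volume))
    (hG : MemLp G (ENNReal.ofReal p) (ν.prod volume))
    (hF0 : ∀ z, z.2 ∉ Ioc 0 T → F z = 0) (hG0 : ∀ z, z.2 ∉ Ioc 0 T → G z = 0) :
    Integrable (fun y : ℝ × (X × ℝ) => (inner ℝ (F y.2) (G (y.2.1, y.1)) : ℝ))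
      ((volume : Measure ℝ).prod (ν.prod volume)) := by
  have hσ := measurePreserving_swapTime (ν := ν)
  have hFm : AEStronglyMeasurable (fun y : ℝ × (X × ℝ) => F y.2)
      ((volume : Measure ℝ).prod (ν.prod volume)) :=
    hF.1.comp_quasiMeasurePreserving Measure.quasiMeasurePreserving_snd
  have hGm : AEStronglyMeasurable (fun y : ℝ × (X × ℝ) => G (y.2.1, y.1))
      ((volume : Measure ℝ).prod (ν.prod volume)) :=
    (hG.1.comp_quasiMeasurePreserving Measure.quasiMeasurePreserving_snd).comp_quasiMeasurePreserving
      hσ.quasiMeasurePreserving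
  have hχ : Integrable (indicator (Ioc 0 T) (fun _ : ℝ => (1 : ℝ))) :=
    (integrable_indicator_iff measurableSet_Ioc).2 (integrableOn_const (by simp))
  have hFi : Integrable (fun z => ‖F z‖ ^ q) (ν.prod volume) := by
    have := hF.integrable_norm_rpow (by simpa using hpq.symm.pos) ENNReal.ofReal_ne_top
    rwa [ENNReal.toReal_ofReal hpq.symm.nonneg] at this
  have hGi : Integrable (fun z => ‖G z‖ ^ p) (ν.prod volume) := by
    have := hG.integrable_norm_rpow (by simpa using hpq.pos) ENNReal.ofReal_ne_top
    rwa [ENNReal.toReal_ofReal hpq.nonneg] at this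
  have b1 := hχ.mul_prod hFi
  have b2 := hσ.integrable_comp_of_integrable (hχ.mul_prod hGi)
  refine (b1.add b2).mono' (hFm.inner hGm) (ae_of_all _ fun y => ?_)
  obtain ⟨s, x, t⟩ := y
  simp only [Function.comp_def, swapTime, Pi.add_apply]
  by_cases hs : s ∈ Ioc 0 T
  · by_cases ht : t ∈ Ioc 0 T
    · rw [indicator_of_mem hs, indicator_of_mem ht, one_mul, one_mul]
      refine (norm_inner_le_norm _ _).trans ?_
      refine (Real.young_inequality_of_nonneg (norm_nonneg _) (norm_nonneg _) hpq.symm).trans ?_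
      exact add_le_add (div_le_self (by positivity) (Real.HolderTriple.lt hpq.symm).le)
        (div_le_self (by positivity) (Real.HolderTriple.lt hpq).le)
    · rw [hF0 (x, t) ht, inner_zero_left, norm_zero]
      have : ∀ a, 0 ≤ indicator (Ioc 0 T) (fun _ : ℝ => (1 : ℝ)) a := fun a =>
        indicator_nonneg (fun _ _ => zero_le_one) a
      exact add_nonneg (mul_nonneg (this _) (by positivity)) (mul_nonneg (this _) (by positivity))
  · rw [hG0 (x, s) hs, inner_zero_right, norm_zero]
    have : ∀ a, 0 ≤ indicator (Ioc 0 T) (fun _ : ℝ => (1 : ℝ)) a := fun a =>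
      indicator_nonneg (fun _ _ => zero_le_one) a
    exact add_nonneg (mul_nonneg (this _) (by positivity)) (mul_nonneg (this _) (by positivity))

/-- The mollified space-time pairing as an average of translated pairings. -/
lemma integral_cross_inner_eq (hpq : p.HolderConjugate q)
    (hF : MemLp F (ENNReal.ofReal q) (ν.prod volume))
    (hG : MemLp G (ENNReal.ofReal p) (ν.prod volume))
    (hF0 : ∀ z, z.2 ∉ Ioc 0 T → F z = 0) (hG0 : ∀ z, z.2 ∉ Ioc 0 T → G z = 0)
    {ψ : ℝ → ℝ} (hψ : Continuous ψ) {c : ℝ} (hc : ∀ r, |ψ r| ≤ c) :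
    Integrable (fun r => ψ r * ∫ z, (inner ℝ (F (z.1, z.2 + r)) (G z) : ℝ) ∂(ν.prod volume)) ∧
    ∫ s, ∫ z, inner ℝ (F z) (G (z.1, s)) * ψ (z.2 - s) ∂(ν.prod volume) =
      ∫ r, ψ r * ∫ z, (inner ℝ (F (z.1, z.2 + r)) (G z) : ℝ) ∂(ν.prod volume) := by
  have hk : Integrable (fun y : ℝ × (X × ℝ) =>
      (inner ℝ (F y.2) (G (y.2.1, y.1)) : ℝ) * ψ (y.2.2 - y.1))
      ((volume : Measure ℝ).prod (ν.prod volume)) := by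
    refine (integrable_cross_inner hpq hF hG hF0 hG0).mul_bdd (c := c) ?_ (ae_of_all _ fun y => ?_)
    · exact (by fun_prop : Measurable fun y : ℝ × (X × ℝ) => ψ (y.2.2 - y.1)).aestronglyMeasurable
    · exact hc _
  -- This map sends (r, (x, s)) to (s, (x, r + s)): the substitution t = s + r.
  have hΘ := (measurePreserving_shear (ν := ν)).comp (measurePreserving_swapTime (ν := ν))
  have hk2 := hΘ.integrable_comp_of_integrable hk
  have e : ∀ y : ℝ × (X × ℝ), ((fun y : ℝ × (X × ℝ) =>
      (inner ℝ (F y.2) (G (y.2.1, y.1)) : ℝ) * ψ (y.2.2 - y.1)) ∘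
      ((fun y : ℝ × (X × ℝ) => (y.1, (y.2.1, y.2.2 + y.1))) ∘ swapTime)) y
      = ψ y.1 * inner ℝ (F (y.2.1, y.2.2 + y.1)) (G y.2) := by
    rintro ⟨r, x, s⟩
    simp only [Function.comp_def, swapTime, add_sub_cancel_right]
    rw [add_comm r s, mul_comm]
  have hk3 : Integrable (fun y : ℝ × (X × ℝ) =>
      ψ y.1 * (inner ℝ (F (y.2.1, y.2.2 + y.1)) (G y.2) : ℝ))
      ((volume : Measure ℝ).prod (ν.prod volume)) := hk2.congr (ae_of_all _ e)
  constructor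
  · have := hk3.integral_prod_left
    simpa only [integral_const_mul] using this
  · rw [← integral_prod _ hk]
    have h1 : ∫ y, ((fun y : ℝ × (X × ℝ) =>
        (inner ℝ (F y.2) (G (y.2.1, y.1)) : ℝ) * ψ (y.2.2 - y.1)) ∘
        ((fun y : ℝ × (X × ℝ) => (y.1, (y.2.1, y.2.2 + y.1))) ∘ swapTime)) y
        ∂((volume : Measure ℝ).prod (ν.prod volume)) = _ :=
      (integral_map hΘ.measurable.aemeasurable
        (by rw [hΘ.map_eq]; exact hk.aestronglyMeasurable)).symm
    rw [hΘ.map_eq] at h1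
    rw [← h1, integral_congr_ae (ae_of_all _ e), integral_prod _ hk3]
    simp only [integral_const_mul]

end Mollify

section
variable {N : ℕ} {V : Type*} [NormedAddCommGroup V] [InnerProductSpace ℝ V] {p q T : ℝ}

/-- The mollified space-time pairing approximates the pairing, uniformly in the second factor. -/
lemma exists_abs_mollified_pairing_sub_le (hpq : p.HolderConjugate q) {F : Euc N × ℝ → V}
    (hF : MemLp F (ENNReal.ofReal q) volume) (hF0 : ∀ z, z.2 ∉ Ioc 0 T → F z = 0)
    {ε : ℝ} (hε : 0 < ε) :
    ∃ h₀ > 0, ∀ h, 0 < h → h < h₀ → ∀ G : Euc N × ℝ → V,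
      MemLp G (ENNReal.ofReal p) volume → (∀ z, z.2 ∉ Ioc 0 T → G z = 0) →
      |(∫ s, ∫ z, inner ℝ (F z) (G (z.1, s)) * timeKernel h (z.2 - s))
        - (∫ r, timeKernel 1 r) * ∫ z, (inner ℝ (F z) (G z) : ℝ)|
        ≤ (∫ r, timeKernel 1 r) * (ε * (eLpNorm G (ENNReal.ofReal p) volume).toReal) := by
  -- Translation continuity is used for F only. This gives uniformity in G, needed because the
  -- truncated G will depend on h.
  have htr := tendsto_eLpNorm_comp_sub (ν := (volume : Measure (Euc N × ℝ)))
    (by simpa using (Real.HolderTriple.lt hpq.symm).le) ENNReal.ofReal_ne_top hF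
    (fun (r : ℝ) z => (z.1, z.2 + r)) (by simp only [Function.uncurry_def]; fun_prop)
    (fun r => measurePreserving_timeShift r) 0 (by ext z <;> simp)
  have hev := htr.eventually_le_const (u := ENNReal.ofReal ε) (by simpa using hε)
  obtain ⟨h₀, hh₀, H⟩ := Metric.eventually_nhds_iff.1 hev
  refine ⟨h₀, hh₀, fun h hh hlt G hG hG0 => ?_⟩
  obtain ⟨hint, heq⟩ := integral_cross_inner_eq (ν := (volume : Measure (Euc N))) hpq hF hG hF0 hG0
    (continuous_timeKernel h) (c := 1 / h) (fun r => by
      rw [abs_of_nonneg (timeKernel_nonneg hh r)]; exact timeKernel_le hh r)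
  rw [← Measure.volume_eq_prod] at hint heq
  have hFr : ∀ r : ℝ, MemLp (fun z : Euc N × ℝ => F (z.1, z.2 + r)) (ENNReal.ofReal q) volume :=
    fun r => hF.comp_measurePreserving (measurePreserving_timeShift r)
  rw [heq, ← integral_timeKernel hh, ← integral_mul_const, ← integral_mul_const,
    ← integral_sub hint ((integrable_timeKernel hh).mul_const _)]
  rw [← Real.norm_eq_abs]
  refine (norm_integral_le_of_norm_le ((integrable_timeKernel hh).mul_const
    (ε * (eLpNorm G (ENNReal.ofReal p) volume).toReal)) (ae_of_all _ fun r => ?_))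
  rw [← mul_sub, norm_mul, Real.norm_of_nonneg (timeKernel_nonneg hh r)]
  rcases le_total h |r| with hr | hr
  · simp [timeKernel_eq_zero hh hr]
  refine mul_le_mul_of_nonneg_left ?_ (timeKernel_nonneg hh r)
  rw [← integral_sub (integrable_inner_of_memLp hpq.symm (hFr r) hG)
    (integrable_inner_of_memLp hpq.symm hF hG)]
  simp_rw [← inner_sub_left]
  refine (abs_integral_inner_le hpq.symm ((hFr r).sub hF) hG).trans ?_
  refine mul_le_mul_of_nonneg_right ?_ ENNReal.toReal_nonneg
  have := H (y := r) (by rw [Real.dist_eq, sub_zero]; linarith)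
  exact ENNReal.toReal_le_of_le_ofReal hε.le this

end

end
end ParabolicSystem

/-! ### Product test functions and L²-valued curves -/

namespace ParabolicSystem
noncomputable section

variable {N k : ℕ} {E : Set (Euc N)} {T p : ℝ}

lemma cylinderMeasure_eq_prod (E : Set (Euc N)) (T : ℝ) :
    cylinderMeasure E T = (volume.restrict E).prod (volume.restrict (Ioc 0 T)) := by
  rw [Measure.prod_restrict, ← Measure.volume_eq_prod]; rfl

lemma IsSmoothCompact.const_smul {X Y : Type*} [NormedAddCommGroup X] [NormedSpace ℝ X]
    [NormedAddCommGroup Y] [NormedSpace ℝ Y] {U : Set X} {φ : X → Y} (h : IsSmoothCompact U φ)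
    (c : ℝ) : IsSmoothCompact U (fun x => c • φ x) where
  smooth := contDiff_const.smul h.smooth
  compact := h.compact.smul_left (f := fun _ => c)
  support := (tsupport_smul_subset_right (fun _ => c) φ).trans h.support

lemma classicalGrad_const_smul {φ : Euc N → Euc k} (hφ : ContDiff ℝ ∞ φ) (c : ℝ) (x : Euc N) :
    classicalGrad (fun y => c • φ y) x = c • classicalGrad φ x := by
  ext ji
  have hd : DifferentiableAt ℝ φ x := (hφ.differentiable (by simp)) x
  simp [classicalGrad, partialDeriv, fderiv_fun_const_smul hd]

lemma MemSobolevZero.const_smul {u : Euc N → Euc k} {Du : Euc N → GradSpace k N}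
    (h : MemSobolevZero E p u Du) (c : ℝ) :
    MemSobolevZero E p (fun x => c • u x) (fun x => c • Du x) where
  memLp := h.memLp.const_smul c
  memLp_grad := h.memLp_grad.const_smul c
  weakGrad φ hφ j i := by
    have := h.weakGrad φ hφ j i
    simp only [PiLp.smul_apply, smul_eq_mul, mul_assoc, integral_const_mul, this, mul_neg]
  approx ε hε := by
    -- The summand 1 covers c = 0.
    obtain ⟨φ, hφ, h1, h2⟩ := h.approx (ε / (|c| + 1)) (by positivity)
    have hε' : ‖c‖ₑ * ENNReal.ofReal (ε / (|c| + 1)) ≤ ENNReal.ofReal ε := by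
      rw [Real.enorm_eq_ofReal_abs, ← ENNReal.ofReal_mul (abs_nonneg c)]
      apply ENNReal.ofReal_le_ofReal
      rw [← mul_div_assoc, div_le_iff₀ (by positivity)]
      nlinarith [abs_nonneg c]
    refine ⟨fun x => c • φ x, hφ.const_smul c, ?_, ?_⟩
    · have e : (fun x => c • u x - c • φ x) = c • fun x => u x - φ x := by
        ext1 x; simp [smul_sub]
      rw [e, eLpNorm_const_smul]
      exact (mul_le_mul_right h1 _).trans hε'
    · have e : (fun x => c • Du x - classicalGrad (fun y => c • φ y) x)
          = c • fun x => Du x - classicalGrad φ x := by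
        ext1 x; simp [classicalGrad_const_smul hφ.smooth, smul_sub]
      rw [e, eLpNorm_const_smul]
      exact (mul_le_mul_right h2 _).trans hε'

lemma memLp_smul_prod {V : Type*} [NormedAddCommGroup V] [NormedSpace ℝ V] {r : ℝ≥0∞}
    {g : Euc N → V} (hg : MemLp g r (volume.restrict E)) {η : ℝ → ℝ} (hη : Continuous η) :
    MemLp (fun z : Euc N × ℝ => η z.2 • g z.1) r (cylinderMeasure E T) := by
  have hg1 : MemLp (fun z : Euc N × ℝ => g z.1) r (cylinderMeasure E T) := by
    rw [cylinderMeasure_eq_prod]; exact hg.comp_fst _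
  obtain ⟨c, hc⟩ := (isCompact_Icc (a := 0) (b := T)).exists_bound_of_continuousOn hη.continuousOn
  refine hg1.of_le_mul (c := c) ?_ ?_
  · exact (hη.comp continuous_snd).aestronglyMeasurable.smul hg1.1
  · have h2 : ∀ᵐ z ∂(cylinderMeasure E T), z.2 ∈ Ioc 0 T := by
      rw [cylinderMeasure_eq_prod]
      exact Measure.quasiMeasurePreserving_snd.ae (ae_restrict_mem measurableSet_Ioc)
    filter_upwards [h2] with z hz
    rw [norm_smul]
    gcongr
    exact hc z.2 (Ioc_subset_Icc_self hz)

/-- Products of a `C¹` function of time and a function of `W₀^{1,p} ∩ L²` are admissible. -/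
lemma isTestFunction_smul (hT : 0 < T) {η η' : ℝ → ℝ} (hη : ∀ t, HasDerivAt η (η' t) t)
    (hη' : Continuous η') (hηT : η T = 0) {g : Euc N → Euc k} {Dg : Euc N → GradSpace k N}
    (hg2 : MemLp g 2 (volume.restrict E)) (hg : MemSobolevZero E p g Dg) :
    IsTestFunction E T p (fun z => η z.2 • g z.1) (fun z => η z.2 • Dg z.1)
      (fun z => η' z.2 • g z.1) := by
  have hηc : Continuous η := continuous_iff_continuousAt.2 fun t => (hη t).continuousAt
  refine ⟨⟨memLp_smul_prod hg2 hηc, memLp_smul_prod hg2 hη', ?_, ?_⟩,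
    ⟨memLp_smul_prod hg.memLp hηc, memLp_smul_prod hg.memLp_grad hηc,
      ae_of_all _ fun t => hg.const_smul (η t)⟩, ae_of_all _ fun x => by simp [hηT]⟩
  · intro χ hχ
    refine ae_of_all _ fun x => ?_
    have h0 : χ 0 = 0 := image_eq_zero_of_notMem_tsupport fun h => lt_irrefl _ (hχ.support h).1
    have hTχ : χ T = 0 := image_eq_zero_of_notMem_tsupport fun h => lt_irrefl _ (hχ.support h).2
    have hd : ∀ t, HasDerivAt χ (deriv χ t) t := fun t =>
      ((hχ.smooth.differentiable (by simp)) t).hasDerivAt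
    have hdc : Continuous (deriv χ) := hχ.smooth.continuous_deriv (by simp)
    have ibp := intervalIntegral.integral_mul_deriv_eq_deriv_mul (a := 0) (b := T)
      (u := χ) (v := η) (u' := deriv χ) (v' := η') (fun t _ => hd t) (fun t _ => hη t)
      (hdc.intervalIntegrable _ _) (hη'.intervalIntegrable _ _)
    rw [h0, hTχ, zero_mul, zero_mul, sub_zero, zero_sub,
      intervalIntegral.integral_of_le hT.le, intervalIntegral.integral_of_le hT.le] at ibp
    simp only [smul_smul, integral_smul_const]
    rw [ibp, neg_smul, neg_neg]
  · refine ⟨fun t _ => hg2.const_smul (η t), fun t _ => ?_⟩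
    have e : ∀ s, eLpNorm (fun x => η s • g x - η t • g x) 2 (volume.restrict E)
        = ‖η s - η t‖ₑ * eLpNorm g 2 (volume.restrict E) := by
      intro s
      have : (fun x => η s • g x - η t • g x) = (η s - η t) • g := by
        ext1 x; simp [sub_smul]
      rw [this, eLpNorm_const_smul]
    simp only [e]
    have h1 : Tendsto (fun s => ‖η s - η t‖ₑ) (𝓝[Icc 0 T] t) (𝓝 0) := by
      have : Continuous fun s => ‖η s - η t‖ₑ := (hηc.sub continuous_const).enorm
      have := (this.tendsto t).mono_left (nhdsWithin_le_nhds (s := Icc 0 T))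
      simpa using this
    simpa using ENNReal.Tendsto.mul_const h1 (Or.inr hg2.2.ne)

/-- The `L²`-valued curve of an element of `C([0, T]; L²)`, extended continuously to `ℝ`. -/
lemma ContinuousInL2.exists_curve (hT : 0 < T) {u : Euc N × ℝ → Euc k}
    (hu : ContinuousInL2 E T u) :
    ∃ U : ℝ → Lp (Euc k) 2 (volume.restrict E), Continuous U ∧
      ∀ t ∈ Icc 0 T, U t =ᵐ[volume.restrict E] fun x => u (x, t) := by
  let f : Icc 0 T → Lp (Euc k) 2 (volume.restrict E) := fun t => (hu.memLp t t.2).toLp _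
  have hf : Continuous f := by
    rw [continuous_iff_continuousAt]
    intro t
    rw [ContinuousAt, tendsto_iff_edist_tendsto_0]
    have h := hu.tendsto t t.2
    rw [nhdsWithin_eq_map_subtype_coe t.2, tendsto_map'_iff] at h
    refine h.congr fun s => ?_
    rw [Lp.edist_toLp_toLp]
    rfl
  refine ⟨IccExtend hT.le f, hf.Icc_extend', fun t ht => ?_⟩
  rw [IccExtend_of_mem hT.le f ht]
  exact (hu.memLp t ht).coeFn_toLp

/-- Tonelli, since t ↦ ‖U t‖² is continuous. Joint measurability is assumed separately because the
curve sees only time slices. -/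
lemma memLp_two_cylinder {u : Euc N × ℝ → Euc k} {U : ℝ → Lp (Euc k) 2 (volume.restrict E)}
    (hU : Continuous U) (hUu : ∀ t ∈ Icc 0 T, U t =ᵐ[volume.restrict E] fun x => u (x, t))
    (hum : AEStronglyMeasurable u (cylinderMeasure E T)) : MemLp u 2 (cylinderMeasure E T) := by
  rw [memLp_two_iff_integrable_sq_norm hum]
  have hm : AEStronglyMeasurable (fun z => ‖u z‖ ^ 2) (cylinderMeasure E T) := hum.norm.pow 2
  rw [cylinderMeasure_eq_prod] at hm ⊢
  rw [integrable_prod_iff' hm]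
  have hmem : ∀ᵐ t ∂(volume.restrict (Ioc 0 T)), t ∈ Icc 0 T :=
    (ae_restrict_mem measurableSet_Ioc).mono fun t ht => Ioc_subset_Icc_self ht
  constructor
  · filter_upwards [hmem] with t ht
    have := (Lp.memLp (U t)).integrable_norm_pow (by norm_num)
    refine this.congr ?_
    filter_upwards [hUu t ht] with x hx
    simp [hx]
  · have hc : Integrable (fun t => ‖U t‖ ^ 2) (volume.restrict (Ioc 0 T)) :=
      ((hU.norm.pow 2).integrableOn_Icc (a := 0) (b := T)).mono_set Ioc_subset_Icc_self
    refine hc.congr ?_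
    filter_upwards [hmem] with t ht
    rw [← real_inner_self_eq_norm_sq, L2.inner_def]
    refine integral_congr_ae ?_
    filter_upwards [hUu t ht] with x hx
    simp [hx]

/-- The space-time pairing with a product test function, in terms of the `L²`-valued curve. -/
lemma integral_inner_smul_eq {u : Euc N × ℝ → Euc k} {U : ℝ → Lp (Euc k) 2 (volume.restrict E)}
    (hU : Continuous U) (hUu : ∀ t ∈ Icc 0 T, U t =ᵐ[volume.restrict E] fun x => u (x, t))
    (hum : AEStronglyMeasurable u (cylinderMeasure E T)) {g : Euc N → Euc k}
    {G : Lp (Euc k) 2 (volume.restrict E)} (hG : G =ᵐ[volume.restrict E] g) {η : ℝ → ℝ}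
    (hη : Continuous η) :
    Integrable (fun z => (inner ℝ (u z) (η z.2 • g z.1) : ℝ)) (cylinderMeasure E T) ∧
    ∫ z, inner ℝ (u z) (η z.2 • g z.1) ∂(cylinderMeasure E T)
      = ∫ t in Ioc 0 T, η t * inner ℝ (U t) G := by
  have hg : MemLp g 2 (volume.restrict E) := (memLp_congr_ae hG).1 (Lp.memLp G)
  have hint : Integrable (fun z => (inner ℝ (u z) (η z.2 • g z.1) : ℝ)) (cylinderMeasure E T) := by
    have hpq : Real.HolderConjugate 2 2 := Real.HolderConjugate.two_two
    refine integrable_inner_of_memLp hpq ?_ ?_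
    · simpa using memLp_two_cylinder hU hUu hum
    · simpa using memLp_smul_prod hg hη
  refine ⟨hint, ?_⟩
  rw [cylinderMeasure_eq_prod] at hint ⊢
  rw [integral_prod_symm _ hint]
  refine integral_congr_ae ?_
  filter_upwards [ae_restrict_mem measurableSet_Ioc] with t ht
  simp only [real_inner_smul_right, integral_const_mul]
  congr 1
  rw [L2.inner_def]
  refine integral_congr_ae ?_
  filter_upwards [hUu t (Ioc_subset_Icc_self ht), hG] with x hx hx'
  simp [hx, hx']

/-- On [0, h] the function -h k_h' is nonnegative with integral h k_h(0) = 1, hence a one-sided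
approximate identity at 0. -/
lemma tendsto_integral_timeKernelDeriv {f : ℝ → ℝ} (hf : Continuous f) (hT : 0 < T) :
    Tendsto (fun h => ∫ t in Ioc 0 T, (h * timeKernelDeriv h t) * f t) (𝓝[>] 0) (𝓝 (-f 0)) := by
  rw [Metric.tendsto_nhds]
  intro ε hε
  -- The bound |h k_h'| ≤ 4/h on an interval of length h gives an error of at most 4ε/5.
  obtain ⟨δ, hδ, H⟩ := Metric.continuousAt_iff.1 (hf.continuousAt (x := 0)) (ε / 5) (by positivity)
  filter_upwards [Ioo_mem_nhdsGT (lt_min hδ hT)] with h hh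
  have hh0 : 0 < h := hh.1
  have hhT : h < T := hh.2.trans_le (min_le_right _ _)
  have hk := continuous_timeKernelDeriv h
  have hint : ∀ (φ : ℝ → ℝ) (hφ : Continuous φ) (a b : ℝ), IntervalIntegrable φ volume a b :=
    fun φ hφ a b => hφ.intervalIntegrable a b
  have htail : ∀ φ : ℝ → ℝ, ∫ t in h..T, (h * timeKernelDeriv h t) * φ t = 0 := by
    intro φ
    rw [← intervalIntegral.integral_zero (a := h) (b := T) (μ := volume)]
    refine intervalIntegral.integral_congr fun t ht => ?_
    rw [uIcc_of_le hhT.le] at ht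
    simp [timeKernelDeriv_eq_zero hh0 (ht.1.trans (le_abs_self t))]
  have hred : ∀ φ : ℝ → ℝ, Continuous φ → ∫ t in Ioc 0 T, (h * timeKernelDeriv h t) * φ t
      = ∫ t in (0 : ℝ)..h, (h * timeKernelDeriv h t) * φ t := by
    intro φ hφ
    rw [← intervalIntegral.integral_of_le hT.le,
      ← intervalIntegral.integral_add_adjacent_intervals (b := h) (hint _ (by fun_prop) _ _)
        (hint _ (by fun_prop) _ _), htail, add_zero]
  have hone : ∫ t in (0 : ℝ)..h, (h * timeKernelDeriv h t) * f 0 = -f 0 := by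
    rw [intervalIntegral.integral_mul_const, intervalIntegral.integral_const_mul,
      intervalIntegral.integral_eq_sub_of_hasDerivAt (fun t _ => hasDerivAt_timeKernel h t)
        (hint _ hk _ _), timeKernel_eq_zero hh0 (le_abs_self h)]
    simp [timeKernel, hh0.ne']
  rw [hred f hf, dist_eq_norm, ← hone, ← intervalIntegral.integral_sub (hint _ (by fun_prop) _ _) (hint _ (by fun_prop) _ _)]
  have hb := intervalIntegral.norm_integral_le_of_norm_le_const (a := 0) (b := h)
    (C := 4 / h * (ε / 5))
    (f := fun t => (h * timeKernelDeriv h t) * f t - (h * timeKernelDeriv h t) * f 0) (by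
      intro t ht
      rw [uIoc_of_le hh0.le] at ht
      have h1 : |f t - f 0| < ε / 5 := by
        have := H (x := t) (by
          rw [Real.dist_eq, sub_zero, abs_of_pos ht.1]
          exact ht.2.trans_lt (hh.2.trans_le (min_le_left _ _)))
        rwa [Real.dist_eq] at this
      have h2 := abs_timeKernelDeriv_le hh0 t
      rw [← mul_sub, norm_mul, norm_mul, Real.norm_of_nonneg hh0.le, Real.norm_eq_abs,
        Real.norm_eq_abs]
      refine mul_le_mul ?_ h1.le (abs_nonneg _) (by positivity)
      calc h * |timeKernelDeriv h t| ≤ h * (4 / h ^ 2) := by gcongr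
        _ = 4 / h := by field_simp)
  rw [sub_zero, abs_of_pos hh0] at hb
  refine hb.trans_lt ?_
  rw [show 4 / h * (ε / 5) * h = 4 * (ε / 5) by field_simp]
  linarith

end
end ParabolicSystem

/-! ### Weak formulations along product test functions; initial values -/

namespace ParabolicSystem
noncomputable section

variable {N k : ℕ} {E : Set (Euc N)} {T p μ : ℝ}

lemma isFiniteMeasure_restrict (hE : Bornology.IsBounded E) :
    IsFiniteMeasure ((volume : Measure (Euc N)).restrict E) :=
  ⟨by simpa using hE.measure_lt_top⟩

lemma isFiniteMeasure_cylinderMeasure (hE : Bornology.IsBounded E) :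
    IsFiniteMeasure (cylinderMeasure E T) := by
  have := isFiniteMeasure_restrict hE
  rw [cylinderMeasure_eq_prod]
  infer_instance

section
variable {α : Type*} [MeasurableSpace α] {ν : Measure α} [IsFiniteMeasure ν]
  {D : α → GradSpace k N}

lemma memLp_sqrt_sq_add_norm_sq {r : ℝ≥0∞} (hμ : 0 < μ) (hD : MemLp D r ν) :
    MemLp (fun z => √(μ ^ 2 + ‖D z‖ ^ 2)) r ν := by
  refine ((memLp_const μ).add hD.norm).mono' ?_ (ae_of_all _ fun z => ?_)
  · exact (by fun_prop : Continuous fun ξ : GradSpace k N =>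
      √(μ ^ 2 + ‖ξ‖ ^ 2)).comp_aestronglyMeasurable hD.1
  · rw [Real.norm_of_nonneg (Real.sqrt_nonneg _), Pi.add_apply]
    apply Real.sqrt_le_iff.2
    constructor
    · positivity
    · nlinarith [norm_nonneg (D z)]

lemma memLp_smul_flux (hp : 1 < p) (hμ : 0 < μ) (hD : MemLp D (ENNReal.ofReal p) ν) {a : α → ℝ}
    (ha : MemLp a ⊤ ν) :
    MemLp (fun z => a z • flux p μ (D z)) (ENNReal.ofReal (p / (p - 1))) ν := by
  have hp1 : 0 < p - 1 := by linarith
  have h1 := (memLp_sqrt_sq_add_norm_sq hμ hD).norm_rpow_div (ENNReal.ofReal (p - 1))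
  rw [ENNReal.toReal_ofReal hp1.le, ← ENNReal.ofReal_div_of_pos hp1] at h1
  have hm : AEStronglyMeasurable (fun z => flux p μ (D z)) ν := by
    refine Continuous.comp_aestronglyMeasurable (g := flux p μ) ?_ hD.1
    unfold flux
    refine Continuous.smul (Continuous.rpow_const (by fun_prop) fun ξ => Or.inl ?_) continuous_id
    positivity
  have h2 : MemLp (fun z => flux p μ (D z)) (ENNReal.ofReal (p / (p - 1))) ν := by
    refine h1.mono' hm (ae_of_all _ fun z => ?_)
    rw [Real.norm_of_nonneg (Real.sqrt_nonneg _)]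
    exact norm_smul_flux_le hμ _
  exact h2.smul (p := ⊤) ha

lemma integrable_energy (hp : 1 < p) (hμ : 0 < μ) (hD : MemLp D (ENNReal.ofReal p) ν) :
    Integrable (fun z => (μ ^ 2 + ‖D z‖ ^ 2) ^ (p / 2)) ν := by
  have h := (memLp_sqrt_sq_add_norm_sq hμ hD).integrable_norm_rpow
    (by simp only [ne_eq, ENNReal.ofReal_eq_zero, not_le]; linarith) ENNReal.ofReal_ne_top
  rw [ENNReal.toReal_ofReal (by linarith)] at h
  refine h.congr (ae_of_all _ fun z => ?_)
  simp only
  rw [Real.norm_of_nonneg (Real.sqrt_nonneg _), Real.sqrt_eq_rpow, ← Real.rpow_mul (by positivity)]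
  congr 1; ring

end

variable {a b : Euc N × ℝ → ℝ} {v w : Euc N × ℝ → Euc k} {Dv Dw : Euc N × ℝ → GradSpace k N}
  {V W : ℝ → Lp (Euc k) 2 (volume.restrict E)}
  {g : Euc N → Euc k} {Dg : Euc N → GradSpace k N} {G : Lp (Euc k) 2 (volume.restrict E)}

lemma integrable_mul_inner_flux (hp : 1 < p) (hμ : 0 < μ) (hE : Bornology.IsBounded E)
    (hb : MemLp b ⊤ (cylinderMeasure E T)) (hDw : MemLp Dw (ENNReal.ofReal p) (cylinderMeasure E T))
    (hg : MemSobolevZero E p g Dg) {η : ℝ → ℝ} (hη : Continuous η) :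
    Integrable (fun z => b z * (inner ℝ (flux p μ (Dw z)) (η z.2 • Dg z.1) : ℝ))
      (cylinderMeasure E T) := by
  have := isFiniteMeasure_restrict hE
  have := isFiniteMeasure_cylinderMeasure (T := T) hE
  have h := integrable_inner_of_memLp (Real.HolderConjugate.conjExponent hp).symm
    (memLp_smul_flux hp hμ hDw hb) (memLp_smul_prod (T := T) hg.memLp_grad hη)
  simpa only [real_inner_smul_left] using h

/-- Here η need not vanish at 0, which gives access to the initial condition. -/
lemma cauchyDirichlet_weakForm (hp : 1 < p) (hμ : 0 < μ) (hE : Bornology.IsBounded E) (hT : 0 < T)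
    (hb : MemLp b ⊤ (cylinderMeasure E T))
    (hw : IsCauchyDirichletSolution E T p μ b v Dv (fun x => v (x, 0)) w Dw)
    (hVv : ∀ t ∈ Icc 0 T, V t =ᵐ[volume.restrict E] fun x => v (x, t))
    (hW : Continuous W) (hWw : ∀ t ∈ Icc 0 T, W t =ᵐ[volume.restrict E] fun x => w (x, t))
    (hg : MemSobolevZero E p g Dg) (hG : G =ᵐ[volume.restrict E] g)
    {η η' : ℝ → ℝ} (hη : ∀ t, HasDerivAt η (η' t) t) (hη' : Continuous η') (hηT : η T = 0) :
    (∫ t in Ioc 0 T, η' t * inner ℝ (V 0 - W t) G)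
      + ∫ z, b z * inner ℝ (flux p μ (Dw z)) (η z.2 • Dg z.1) ∂(cylinderMeasure E T) = 0 := by
  have := isFiniteMeasure_restrict hE
  have hηc : Continuous η := continuous_iff_continuousAt.2 fun t => (hη t).continuousAt
  have hg2 : MemLp g 2 (volume.restrict E) := (memLp_congr_ae hG).1 (Lp.memLp G)
  have key := hw.weakForm _ _ _ (isTestFunction_smul hT hη hη' hηT hg2 hg)
  have hv0 : MemLp (fun x => v (x, 0)) 2 (volume.restrict E) :=
    (memLp_congr_ae (hVv 0 ⟨le_rfl, hT.le⟩)).1 (Lp.memLp (V 0))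
  have hm0 : AEStronglyMeasurable (fun z : Euc N × ℝ => v (z.1, 0)) (cylinderMeasure E T) := by
    rw [cylinderMeasure_eq_prod]
    exact hv0.1.comp_quasiMeasurePreserving Measure.quasiMeasurePreserving_fst
  obtain ⟨i, e⟩ := integral_inner_smul_eq (T := T) (u := fun z => v (z.1, 0) - w z)
    (U := fun t => V 0 - W t) (continuous_const.sub hW) (fun t ht => by
      filter_upwards [Lp.coeFn_sub (V 0) (W t), hVv 0 ⟨le_rfl, hT.le⟩, hWw t ht] with x h1 h2 h3
      rw [h1, Pi.sub_apply, h2, h3]) (hm0.sub hw.sobolev.memLp.1) hG hη'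
  rw [integral_add i (integrable_mul_inner_flux hp hμ hE hb hw.sobolev.memLp_grad hg hηc), e] at key
  exact key

lemma weakSolution_weakForm (hp : 1 < p) (hμ : 0 < μ) (hE : Bornology.IsBounded E) (hT : 0 < T)
    (ha : MemLp a ⊤ (cylinderMeasure E T)) (hv : IsWeakSolution E T p μ a v Dv)
    (hV : Continuous V) (hVv : ∀ t ∈ Icc 0 T, V t =ᵐ[volume.restrict E] fun x => v (x, t))
    (hg : MemSobolevZero E p g Dg) (hG : G =ᵐ[volume.restrict E] g)
    {η η' : ℝ → ℝ} (hη : ∀ t, HasDerivAt η (η' t) t) (hη' : Continuous η') (hη0 : η 0 = 0)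
    (hηT : η T = 0) :
    (∫ t in Ioc 0 T, η' t * inner ℝ (V t) G)
      - ∫ z, a z * inner ℝ (flux p μ (Dv z)) (η z.2 • Dg z.1) ∂(cylinderMeasure E T) = 0 := by
  have hηc : Continuous η := continuous_iff_continuousAt.2 fun t => (hη t).continuousAt
  have := isFiniteMeasure_restrict hE
  have hg2 : MemLp g 2 (volume.restrict E) := (memLp_congr_ae hG).1 (Lp.memLp G)
  have key := hv.weakForm _ _ _ (isTestFunction_smul hT hη hη' hηT hg2 hg)
    (ae_of_all _ fun x => by simp [hη0])
  obtain ⟨i, e⟩ := integral_inner_smul_eq (T := T) hV hVv hv.sobolev.memLp.1 hG hη'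
  rw [integral_sub i (integrable_mul_inner_flux hp hμ hE ha hv.sobolev.memLp_grad hg hηc), e] at key
  exact key

/-- The equation for the difference of the two solutions. -/
lemma weakForm_sub (hp : 1 < p) (hμ : 0 < μ) (hE : Bornology.IsBounded E) (hT : 0 < T)
    (ha : MemLp a ⊤ (cylinderMeasure E T)) (hb : MemLp b ⊤ (cylinderMeasure E T))
    (hv : IsWeakSolution E T p μ a v Dv)
    (hw : IsCauchyDirichletSolution E T p μ b v Dv (fun x => v (x, 0)) w Dw)
    (hV : Continuous V) (hVv : ∀ t ∈ Icc 0 T, V t =ᵐ[volume.restrict E] fun x => v (x, t))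
    (hW : Continuous W) (hWw : ∀ t ∈ Icc 0 T, W t =ᵐ[volume.restrict E] fun x => w (x, t))
    (hg : MemSobolevZero E p g Dg) (hG : G =ᵐ[volume.restrict E] g)
    {η η' : ℝ → ℝ} (hη : ∀ t, HasDerivAt η (η' t) t) (hη' : Continuous η') (hη0 : η 0 = 0)
    (hηT : η T = 0) :
    ∫ t in Ioc 0 T, η' t * inner ℝ (W t - V t) G
      = ∫ z, inner ℝ (b z • flux p μ (Dw z) - a z • flux p μ (Dv z)) (η z.2 • Dg z.1)
        ∂(cylinderMeasure E T) := by
  have hηc : Continuous η := continuous_iff_continuousAt.2 fun t => (hη t).continuousAt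
  have h1 := weakSolution_weakForm hp hμ hE hT ha hv hV hVv hg hG hη hη' hη0 hηT
  have h2 := cauchyDirichlet_weakForm hp hμ hE hT hb hw hVv hW hWw hg hG hη hη' hηT
  have ii : ∀ φ : ℝ → ℝ, Continuous φ → Integrable φ (volume.restrict (Ioc 0 T)) := fun φ hφ =>
    (hφ.integrableOn_Icc (a := 0) (b := T)).mono_set Ioc_subset_Icc_self
  -- The constant initial datum drops out because η vanishes at both ends.
  have h3 : ∫ t in Ioc 0 T, η' t * inner ℝ (V 0) G = 0 := by
    rw [integral_mul_const, ← intervalIntegral.integral_of_le hT.le,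
      intervalIntegral.integral_eq_sub_of_hasDerivAt (fun t _ => hη t)
        (hη'.intervalIntegrable _ _), hη0, hηT]
    simp
  have e1 : ∫ t in Ioc 0 T, η' t * inner ℝ (V 0 - W t) G
      = (∫ t in Ioc 0 T, η' t * inner ℝ (V 0) G) - ∫ t in Ioc 0 T, η' t * inner ℝ (W t) G := by
    rw [← integral_sub (ii _ (by fun_prop)) (ii _ (by fun_prop))]
    simp only [inner_sub_left, mul_sub]
  have e2 : ∫ t in Ioc 0 T, η' t * inner ℝ (W t - V t) G
      = (∫ t in Ioc 0 T, η' t * inner ℝ (W t) G) - ∫ t in Ioc 0 T, η' t * inner ℝ (V t) G := by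
    rw [← integral_sub (ii _ (by fun_prop)) (ii _ (by fun_prop))]
    simp only [inner_sub_left, mul_sub]
  simp only [inner_sub_left, real_inner_smul_left]
  rw [integral_sub (integrable_mul_inner_flux hp hμ hE hb hw.sobolev.memLp_grad hg hηc)
    (integrable_mul_inner_flux hp hμ hE ha hv.sobolev.memLp_grad hg hηc)]
  rw [h3] at e1
  rw [e1] at h2
  simp only [inner_sub_left] at e2
  linarith

/-- Test with η = h k_h, which equals 1 at t = 0 and vanishes for t ≥ h. As h → 0 the flux term
disappears by dominated convergence, and the time term concentrates at t = 0. -/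
lemma inner_initial_eq_zero (hp : 1 < p) (hμ : 0 < μ) (hE : Bornology.IsBounded E) (hT : 0 < T)
    (hb : MemLp b ⊤ (cylinderMeasure E T))
    (hw : IsCauchyDirichletSolution E T p μ b v Dv (fun x => v (x, 0)) w Dw)
    (hVv : ∀ t ∈ Icc 0 T, V t =ᵐ[volume.restrict E] fun x => v (x, t))
    (hW : Continuous W) (hWw : ∀ t ∈ Icc 0 T, W t =ᵐ[volume.restrict E] fun x => w (x, t))
    (hg : MemSobolevZero E p g Dg) (hG : G =ᵐ[volume.restrict E] g) :
    (inner ℝ (W 0 - V 0) G : ℝ) = 0 := by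
  have t1 := tendsto_integral_timeKernelDeriv (f := fun t => (inner ℝ (V 0 - W t) G : ℝ))
    (by fun_prop) hT
  have hmem : ∀ᵐ z ∂(cylinderMeasure E T), z.2 ∈ Ioc 0 T := by
    rw [cylinderMeasure_eq_prod]
    exact Measure.quasiMeasurePreserving_snd.ae (ae_restrict_mem measurableSet_Ioc)
  have hi := integrable_mul_inner_flux hp hμ hE hb hw.sobolev.memLp_grad hg
    (η := fun _ => 1) continuous_const
  have t2 : Tendsto (fun h => ∫ z, b z * inner ℝ (flux p μ (Dw z))
      ((h * timeKernel h z.2) • Dg z.1) ∂(cylinderMeasure E T)) (𝓝[>] 0)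
      (𝓝 (∫ _, (0 : ℝ) ∂(cylinderMeasure E T))) := by
    refine tendsto_integral_filter_of_dominated_convergence _ ?_ ?_ hi.norm ?_
    · exact Eventually.of_forall fun h => (integrable_mul_inner_flux hp hμ hE hb
        hw.sobolev.memLp_grad hg (continuous_const.mul (continuous_timeKernel h))).1
    · filter_upwards [self_mem_nhdsWithin] with h hh
      have hh : 0 < h := hh
      refine ae_of_all _ fun z => ?_
      have h1 : ‖h * timeKernel h z.2‖ ≤ 1 := by
        rw [norm_mul, Real.norm_of_nonneg hh.le, Real.norm_of_nonneg (timeKernel_nonneg hh _)]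
        calc h * timeKernel h z.2 ≤ h * (1 / h) := by gcongr; exact timeKernel_le hh _
          _ = 1 := by field_simp
      rw [one_smul, real_inner_smul_right, mul_left_comm, norm_mul (h * timeKernel h z.2)]
      exact mul_le_of_le_one_left (norm_nonneg _) h1
    · filter_upwards [hmem] with z hz
      refine tendsto_const_nhds.congr' ?_
      filter_upwards [Ioo_mem_nhdsGT hz.1] with h hh
      rw [timeKernel_eq_zero hh.1 (hh.2.le.trans (le_abs_self _))]
      simp
  rw [integral_zero] at t2
  have hsum : Tendsto (fun _ : ℝ => (0 : ℝ)) (𝓝[>] 0) (𝓝 (-(inner ℝ (V 0 - W 0) G : ℝ) + 0)) := by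
    refine (t1.add t2).congr' ?_
    filter_upwards [Ioo_mem_nhdsGT hT] with h hh
    exact cauchyDirichlet_weakForm hp hμ hE hT hb hw hVv hW hWw hg hG
      (η := fun t => h * timeKernel h t) (fun t => (hasDerivAt_timeKernel h t).const_mul h)
      (continuous_const.mul (continuous_timeKernelDeriv h))
      (by rw [timeKernel_eq_zero hh.1 (hh.2.le.trans (le_abs_self _)), mul_zero])
  have := tendsto_nhds_unique hsum tendsto_const_nhds
  rw [← neg_sub (V 0) (W 0), inner_neg_left]
  linarith

/-- Both solutions have the same initial values. -/
lemma initial_sub_eq_zero (hp : 1 < p) (hμ : 0 < μ) (hE : Bornology.IsBounded E) (hT : 0 < T)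
    (hb : MemLp b ⊤ (cylinderMeasure E T))
    (hw : IsCauchyDirichletSolution E T p μ b v Dv (fun x => v (x, 0)) w Dw)
    (hV : Continuous V) (hVv : ∀ t ∈ Icc 0 T, V t =ᵐ[volume.restrict E] fun x => v (x, t))
    (hW : Continuous W) (hWw : ∀ t ∈ Icc 0 T, W t =ᵐ[volume.restrict E] fun x => w (x, t)) :
    W 0 - V 0 = 0 := by
  -- The slices w(s) - v(s) themselves serve as spatial test functions for a.e. s. Continuity
  -- extends the orthogonality to s = 0, so no density argument in L² is needed.
  have hae : (fun s => (inner ℝ (W 0 - V 0) (W s - V s) : ℝ)) =ᵐ[volume.restrict (Icc 0 T)]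
      fun _ => 0 := by
    rw [← restrict_Ioc_eq_restrict_Icc]
    filter_upwards [hw.boundary.slice, ae_restrict_mem measurableSet_Ioc] with s hs hsT
    refine inner_initial_eq_zero hp hμ hE hT hb hw hVv hW hWw hs ?_
    have hsT' := Ioc_subset_Icc_self hsT
    filter_upwards [Lp.coeFn_sub (W s) (V s), hVv s hsT', hWw s hsT'] with x h1 h2 h3
    rw [h1, Pi.sub_apply, h2, h3]
  have := Measure.eqOn_Icc_of_ae_eq volume hT.ne hae (by fun_prop) continuousOn_const
    (left_mem_Icc.2 hT.le)
  exact inner_self_eq_zero.1 this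

end
end ParabolicSystem

/-! ### Energy inequality and integrated estimates -/

namespace ParabolicSystem
noncomputable section

variable {N k : ℕ} {E : Set (Euc N)} {T p μ : ℝ}
  {a b : Euc N × ℝ → ℝ} {v w : Euc N × ℝ → Euc k} {Dv Dw : Euc N × ℝ → GradSpace k N}

/-- The energy inequality for the difference of the two solutions. -/
lemma integral_inner_flux_sub_nonpos (hp : 1 < p) (hμ : 0 < μ) (hEo : IsOpen E)
    (hE : Bornology.IsBounded E) (hT : 0 < T)
    (ha : MemLp a ⊤ (cylinderMeasure E T)) (hb : MemLp b ⊤ (cylinderMeasure E T))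
    (hv : IsWeakSolution E T p μ a v Dv)
    (hw : IsCauchyDirichletSolution E T p μ b v Dv (fun x => v (x, 0)) w Dw) :
    Integrable (fun z => (inner ℝ (b z • flux p μ (Dw z) - a z • flux p μ (Dv z))
      (Dw z - Dv z) : ℝ)) (cylinderMeasure E T) ∧
    ∫ z, inner ℝ (b z • flux p μ (Dw z) - a z • flux p μ (Dv z)) (Dw z - Dv z)
      ∂(cylinderMeasure E T) ≤ 0 := by
  have := isFiniteMeasure_restrict hE
  have := isFiniteMeasure_cylinderMeasure (T := T) hE
  have hcyl : MeasurableSet (cylinder E T) := hEo.measurableSet.prod measurableSet_Ioc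
  have hpq := Real.HolderConjugate.conjExponent hp
  set F : Euc N × ℝ → GradSpace k N :=
    fun z => b z • flux p μ (Dw z) - a z • flux p μ (Dv z) with hFdef
  set D : Euc N × ℝ → GradSpace k N := fun z => Dw z - Dv z with hDdef
  have hF : MemLp F (ENNReal.ofReal (p / (p - 1))) (cylinderMeasure E T) :=
    (memLp_smul_flux hp hμ hw.sobolev.memLp_grad hb).sub
      (memLp_smul_flux hp hμ hv.sobolev.memLp_grad ha)
  have hD : MemLp D (ENNReal.ofReal p) (cylinderMeasure E T) := hw.boundary.memLp_grad
  have hint : Integrable (fun z => (inner ℝ (F z) (D z) : ℝ)) (cylinderMeasure E T) :=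
    integrable_inner_of_memLp hpq.symm hF hD
  refine ⟨hint, ?_⟩
  obtain ⟨V, hV, hVv⟩ := hv.continuous.exists_curve hT
  obtain ⟨W, hW, hWw⟩ := hw.continuous.exists_curve hT
  have h0 := initial_sub_eq_zero hp hμ hE hT hb hw hV hVv hW hWw
  set F' := (cylinder E T).indicator F with hF'
  set D' := (cylinder E T).indicator D with hD'
  have hF'm : MemLp F' (ENNReal.ofReal (p / (p - 1))) volume :=
    (memLp_indicator_iff_restrict hcyl).2 hF
  have hD'm : MemLp D' (ENNReal.ofReal p) volume := (memLp_indicator_iff_restrict hcyl).2 hD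
  have hF0 : ∀ z, z.2 ∉ Ioc 0 T → F' z = 0 := fun z hz => indicator_of_notMem (fun h => hz h.2) _
  have hD0 : ∀ z, z.2 ∉ Ioc 0 T → D' z = 0 := fun z hz => indicator_of_notMem (fun h => hz h.2) _
  set c := ∫ r, timeKernel 1 r with hc
  have hc0 : 0 < c := integral_timeKernel_one_pos
  set K := (eLpNorm D' (ENNReal.ofReal p) volume).toReal with hK
  have hK0 : 0 ≤ K := ENNReal.toReal_nonneg
  -- For s in (h, T - h] the function k_h(t - s) vanishes at t = 0 and t = T, as the equation for v
  -- requires.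
  let S : ℝ → Set (Euc N × ℝ) := fun h => univ ×ˢ Ioc h (T - h)
  have hS : ∀ h, MeasurableSet (S h) := fun h => MeasurableSet.univ.prod measurableSet_Ioc
  have hident : ∀ h, 0 < h → h < T →
      ∫ s, ∫ z, inner ℝ (F' z) ((S h).indicator D' (z.1, s)) * timeKernel h (z.2 - s)
        = ∫ s in Ioc h (T - h), ∫ t in Ioc 0 T,
          inner ℝ (W t - V t) (W s - V s) * timeKernelDeriv h (t - s) := by
    intro h hh hhT
    rw [← integral_indicator measurableSet_Ioc]
    have hsl := (ae_restrict_iff' measurableSet_Ioc).1 hw.boundary.slice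
    refine integral_congr_ae ?_
    filter_upwards [hsl] with s hs
    by_cases hsI : s ∈ Ioc h (T - h)
    · rw [indicator_of_mem hsI]
      have hsT : s ∈ Ioc 0 T := ⟨hh.trans hsI.1, by linarith [hsI.2]⟩
      have hsT' := Ioc_subset_Icc_self hsT
      have hG : (W s - V s : Lp (Euc k) 2 (volume.restrict E)) =ᵐ[volume.restrict E]
          fun x => w (x, s) - v (x, s) := by
        filter_upwards [Lp.coeFn_sub (W s) (V s), hVv s hsT', hWw s hsT'] with x h1 h2 h3
        rw [h1, Pi.sub_apply, h2, h3]
      have key := weakForm_sub hp hμ hE hT ha hb hv hw hV hVv hW hWw (hs hsT) hG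
        (η := fun t => timeKernel h (t - s)) (η' := fun t => timeKernelDeriv h (t - s))
        (fun t => (hasDerivAt_timeKernel h (t - s)).comp_sub_const t s)
        ((continuous_timeKernelDeriv h).comp (continuous_id.sub continuous_const))
        (timeKernel_eq_zero hh (by
          rw [zero_sub, abs_neg]; exact hsI.1.le.trans (le_abs_self _)))
        (timeKernel_eq_zero hh (by
          refine le_trans ?_ (le_abs_self _); linarith [hsI.2]))
      simp only [mul_comm (inner ℝ (W _ - V _) (W s - V s) : ℝ)]
      rw [key, cylinderMeasure, ← integral_indicator hcyl]
      refine integral_congr_ae (ae_of_all _ fun z => ?_)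
      by_cases hz : z ∈ cylinder E T
      · have hz1 : ((z.1, s) : Euc N × ℝ) ∈ S h := ⟨mem_univ _, hsI⟩
        have hz2 : ((z.1, s) : Euc N × ℝ) ∈ cylinder E T := ⟨hz.1, hsT⟩
        simp only [indicator_of_mem hz, hF', indicator_of_mem hz1, hD', indicator_of_mem hz2,
          real_inner_smul_right]
        rw [mul_comm]
      · simp only [indicator_of_notMem hz, hF', inner_zero_left, zero_mul]
    · rw [indicator_of_notMem hsI]
      have : ∀ z : Euc N × ℝ, (S h).indicator D' (z.1, s) = 0 := fun z =>
        indicator_of_notMem (fun hz => hsI hz.2) _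
      simp [this]
  have hbound : ∀ ε > 0, c * ∫ z, inner ℝ (F z) (D z) ∂(cylinderMeasure E T)
      ≤ ε + c * (ε * K) := by
    intro ε hε
    obtain ⟨h₁, hh₁, H₁⟩ := exists_abs_mollified_pairing_sub_le hpq hF'm hF0 hε
    obtain ⟨h₂, hh₂, H₂⟩ := exists_integral_inner_timeKernelDeriv_le (hW.sub hV) h0 hT hε
    have hlim : Tendsto (fun h => c * ∫ z, (S h).indicator (fun z => (inner ℝ (F z) (D z) : ℝ)) z
        ∂(cylinderMeasure E T)) (𝓝[>] 0)
        (𝓝 (c * ∫ z, inner ℝ (F z) (D z) ∂(cylinderMeasure E T))) := by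
      refine Tendsto.const_mul c ?_
      refine tendsto_integral_filter_of_dominated_convergence _ ?_ ?_ hint.norm ?_
      · exact Eventually.of_forall fun h => (hint.indicator (hS h)).1
      · exact Eventually.of_forall fun h => ae_of_all _ fun z => norm_indicator_le_norm_self _ z
      · have hmem : ∀ᵐ z ∂(cylinderMeasure E T), z.2 ∈ Ioo 0 T := by
          rw [cylinderMeasure_eq_prod]
          refine Measure.quasiMeasurePreserving_snd.ae (p := fun t => t ∈ Ioo 0 T) ?_
          rw [← Measure.restrict_congr_set Ioo_ae_eq_Ioc]
          exact ae_restrict_mem measurableSet_Ioo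
        filter_upwards [hmem] with z hz
        refine tendsto_const_nhds.congr' ?_
        filter_upwards [Ioo_mem_nhdsGT (lt_min hz.1 (sub_pos.2 hz.2))] with h hh
        have h1 := hh.2.trans_le (min_le_left _ _)
        have h2 := hh.2.trans_le (min_le_right _ _)
        rw [indicator_of_mem]
        exact ⟨mem_univ _, h1, by linarith⟩
    -- For small h, the truncated pairing is within cεK of the mollified one, which equals the time
    -- integral and is at most ε.
    refine le_of_tendsto hlim ?_
    filter_upwards [Ioo_mem_nhdsGT (lt_min (lt_min hh₁ hh₂) (half_pos hT))] with h hh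
    have hh0 : 0 < h := hh.1
    have l1 := hh.2.trans_le ((min_le_left _ _).trans (min_le_left _ _))
    have l2 := hh.2.trans_le ((min_le_left _ _).trans (min_le_right _ _))
    have l3 := hh.2.trans_le (min_le_right _ _)
    have b1 := H₁ h hh0 l1 ((S h).indicator D') (hD'm.indicator (hS h)) (fun z hz => by
      rw [indicator_apply_eq_zero]; exact fun _ => hD0 z hz)
    have b2 := H₂ h hh0 l2
    rw [intervalIntegral.integral_of_le (by linarith)] at b2
    simp only [intervalIntegral.integral_of_le hT.le, Pi.sub_apply] at b2
    rw [hident h hh0 (by linarith)] at b1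
    have e1 : ∫ z, (inner ℝ (F' z) ((S h).indicator D' z) : ℝ)
        = ∫ z, (S h).indicator (fun z => (inner ℝ (F z) (D z) : ℝ)) z ∂(cylinderMeasure E T) := by
      rw [cylinderMeasure, ← integral_indicator hcyl]
      refine integral_congr_ae (ae_of_all _ fun z => ?_)
      by_cases hz : z ∈ cylinder E T
      · by_cases hz' : z ∈ S h
        · simp only [hF', hD', indicator_of_mem hz, indicator_of_mem hz']
        · simp only [indicator_of_mem hz, indicator_of_notMem hz', inner_zero_right]
      · simp only [hF', indicator_of_notMem hz, inner_zero_left]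
    rw [e1] at b1
    have e2 : (eLpNorm ((S h).indicator D') (ENNReal.ofReal p) volume).toReal ≤ K :=
      ENNReal.toReal_mono hD'm.2.ne (eLpNorm_indicator_le _)
    have e3 : c * (ε * (eLpNorm ((S h).indicator D') (ENNReal.ofReal p) volume).toReal)
        ≤ c * (ε * K) := by gcongr
    have := (abs_le.1 b1).1
    linarith
  by_contra hpos
  rw [not_le] at hpos
  set J := ∫ z, inner ℝ (F z) (D z) ∂(cylinderMeasure E T)
  -- This ε makes ε(1 + cK) half of cJ, a contradiction when J > 0.
  have := hbound (c * J / (2 * (1 + c * K))) (by positivity)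
  have e : c * J / (2 * (1 + c * K)) + c * (c * J / (2 * (1 + c * K)) * K) = c * J / 2 := by
    field_simp
  rw [e] at this
  have : 0 < c * J := by positivity
  linarith

/-- Integration of a pointwise bound by the monotone quantity. -/
lemma integral_norm_sub_rpow_le {A Λ B : ℝ} (hp : 1 < p) (hμ : 0 < μ) (hEo : IsOpen E)
    (hE : Bornology.IsBounded E) (hT : 0 < T)
    (ha : MemLp a ⊤ (cylinderMeasure E T)) (hb : MemLp b ⊤ (cylinderMeasure E T))
    (hv : IsWeakSolution E T p μ a v Dv)
    (hw : IsCauchyDirichletSolution E T p μ b v Dv (fun x => v (x, 0)) w Dw)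
    (hΛ : 0 ≤ Λ) {C₀ : ℝ} (hb₀ : ∀ᵐ z ∂(cylinderMeasure E T), C₀ ≤ b z)
    (hA : supNorm E T (fun z => a z - b z) ≤ A)
    (hpt : ∀ (α β : ℝ) (ξ η : GradSpace k N), C₀ ≤ β → |α - β| ≤ A →
      ‖ξ - η‖ ^ p ≤ Λ * inner ℝ (β • flux p μ ξ - α • flux p μ η) (ξ - η)
        + B * (μ ^ 2 + ‖η‖ ^ 2) ^ (p / 2)) :
    ∫ z, ‖Dv z - Dw z‖ ^ p ∂(cylinderMeasure E T) ≤ B * energy E T p μ Dv := by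
  have := isFiniteMeasure_cylinderMeasure (T := T) hE
  obtain ⟨hi, hneg⟩ := integral_inner_flux_sub_nonpos hp hμ hEo hE hT ha hb hv hw
  have hie := integrable_energy hp hμ hv.sobolev.memLp_grad
  have hab : MemLp (fun z => a z - b z) ⊤ (cylinderMeasure E T) := ha.sub hb
  have hAae : ∀ᵐ z ∂(cylinderMeasure E T), |a z - b z| ≤ A := by
    have h1 := ae_le_eLpNormEssSup (f := fun z => a z - b z) (μ := cylinderMeasure E T)
    filter_upwards [h1] with z hz
    refine le_trans ?_ hA
    rw [← eLpNorm_exponent_top] at hz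
    have := ENNReal.toReal_mono hab.2.ne hz
    simpa [supNorm] using this
  have h1 : ∫ z, ‖Dv z - Dw z‖ ^ p ∂(cylinderMeasure E T) ≤
      ∫ z, (Λ * inner ℝ (b z • flux p μ (Dw z) - a z • flux p μ (Dv z)) (Dw z - Dv z)
        + B * (μ ^ 2 + ‖Dv z‖ ^ 2) ^ (p / 2)) ∂(cylinderMeasure E T) := by
    refine integral_mono_of_nonneg (ae_of_all _ fun z => by positivity)
      ((hi.const_mul Λ).add (hie.const_mul B)) ?_
    filter_upwards [hb₀, hAae] with z hz1 hz2
    rw [norm_sub_rev]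
    exact hpt _ _ _ _ hz1 hz2
  rw [integral_add (hi.const_mul Λ) (hie.const_mul B), integral_const_mul, integral_const_mul] at h1
  have := mul_nonpos_of_nonneg_of_nonpos hΛ hneg
  unfold energy
  linarith

lemma energy_le (hp : 1 < p) (hμ : 0 < μ) (hE : Bornology.IsBounded E)
    (hDv : MemLp Dv (ENNReal.ofReal p) (cylinderMeasure E T))
    (hDw : MemLp Dw (ENNReal.ofReal p) (cylinderMeasure E T)) :
    energy E T p μ Dw ≤ 4 ^ p * (energy E T p μ Dv
      + ∫ z, ‖Dv z - Dw z‖ ^ p ∂(cylinderMeasure E T)) := by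
  have := isFiniteMeasure_cylinderMeasure (T := T) hE
  have hie := integrable_energy hp hμ hDv
  have hid : Integrable (fun z => ‖Dv z - Dw z‖ ^ p) (cylinderMeasure E T) := by
    have := (hDv.sub hDw).integrable_norm_rpow
      (by simp only [ne_eq, ENNReal.ofReal_eq_zero, not_le]; linarith) ENNReal.ofReal_ne_top
    rwa [ENNReal.toReal_ofReal (by linarith)] at this
  unfold energy
  rw [← integral_add hie hid, ← integral_const_mul]
  refine integral_mono (integrable_energy hp hμ hDw) ((hie.add hid).const_mul _) fun z => ?_
  simp only
  set ξ := Dw z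
  set η := Dv z
  set d := ‖η - ξ‖
  have hd : 0 ≤ d := norm_nonneg _
  have h1 : ‖ξ‖ ≤ ‖η‖ + d := by
    have := norm_sub_le η (η - ξ); rwa [sub_sub_cancel] at this
  -- The factor 4 would suffice; 4² makes its power p/2 equal to 4^p.
  have hmax : μ ^ 2 + ‖ξ‖ ^ 2 ≤ 4 ^ 2 * max (μ ^ 2 + ‖η‖ ^ 2) (d ^ 2) := by
    have h3 : ‖ξ‖ ^ 2 ≤ (‖η‖ + d) ^ 2 := by gcongr
    have := le_max_left (μ ^ 2 + ‖η‖ ^ 2) (d ^ 2)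
    have := le_max_right (μ ^ 2 + ‖η‖ ^ 2) (d ^ 2)
    nlinarith [sq_nonneg (‖η‖ - d), sq_nonneg μ, sq_nonneg d]
  have hdp : (d ^ 2) ^ (p / 2) = d ^ p := by
    rw [← Real.rpow_natCast, ← Real.rpow_mul hd]; congr 1; push_cast; ring
  have h4p : ((4 : ℝ) ^ 2) ^ (p / 2) = 4 ^ p := by
    rw [← Real.rpow_natCast, ← Real.rpow_mul (by norm_num)]; congr 1; push_cast; ring
  calc (μ ^ 2 + ‖ξ‖ ^ 2) ^ (p / 2)
      ≤ (4 ^ 2 * max (μ ^ 2 + ‖η‖ ^ 2) (d ^ 2)) ^ (p / 2) := by gcongr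
    _ = 4 ^ p * max (μ ^ 2 + ‖η‖ ^ 2) (d ^ 2) ^ (p / 2) := by
        rw [Real.mul_rpow (by norm_num) (by positivity), h4p]
    _ ≤ 4 ^ p * ((μ ^ 2 + ‖η‖ ^ 2) ^ (p / 2) + d ^ p) := by
        gcongr
        have := Real.rpow_nonneg hd p
        have : 0 ≤ (μ ^ 2 + ‖η‖ ^ 2) ^ (p / 2) := by positivity
        rcases max_cases (μ ^ 2 + ‖η‖ ^ 2) (d ^ 2) with ⟨h, _⟩ | ⟨h, _⟩
        · rw [h]; linarith
        · rw [h, hdp]; linarith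

/-- The pointwise bounds need A > 0. They are applied with every A' above the sup norm, and A' then
decreases to it, which covers a = b. -/
lemma le_of_forall_gt_le_of_continuous {f : ℝ → ℝ} (hf : Continuous f) {x A : ℝ}
    (h : ∀ A' > A, x ≤ f A') : x ≤ f A :=
  ge_of_tendsto ((hf.tendsto A).mono_left (nhdsWithin_le_nhds (s := Ioi A)))
    (eventually_mem_nhdsWithin.mono h)

end
end ParabolicSystem

/-! ### Choice of constants and conclusion -/

theorem mainTheorem12 :
    ∀ p : ℝ, 1 < p → ∀ C₀ : ℝ, 0 < C₀ → ∃ C : ℝ, 0 < C ∧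
      ∀ (N k : ℕ) (E : Set (ParabolicSystem.Euc N)) (T μ C₁ : ℝ)
        (a b : ParabolicSystem.Euc N × ℝ → ℝ)
        (v w : ParabolicSystem.Euc N × ℝ → ParabolicSystem.Euc k)
        (Dv Dw : ParabolicSystem.Euc N × ℝ → ParabolicSystem.GradSpace k N),
        IsOpen E → Bornology.IsBounded E → 0 < T → 0 < μ → μ ≤ 1 →
        MemLp a ∞ (ParabolicSystem.cylinderMeasure E T) →
        (∀ᵐ z ∂(ParabolicSystem.cylinderMeasure E T), C₀ ≤ a z ∧ a z ≤ C₁) →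
        MemLp b ∞ (ParabolicSystem.cylinderMeasure E T) →
        (∀ᵐ z ∂(ParabolicSystem.cylinderMeasure E T), C₀ ≤ b z) →
        ParabolicSystem.IsWeakSolution E T p μ a v Dv →
        ParabolicSystem.IsCauchyDirichletSolution E T p μ b v Dv (fun x => v (x, 0)) w Dw →
        (∫ z, ‖Dv z - Dw z‖ ^ p ∂(ParabolicSystem.cylinderMeasure E T)
          ≤ C * (ParabolicSystem.supNorm E T (fun z => a z - b z) ^ p
              + ParabolicSystem.supNorm E T (fun z => a z - b z) ^ (p / (p - 1)))
            * ParabolicSystem.energy E T p μ Dv) ∧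
        (2 ≤ p →
          ∫ z, ‖Dv z - Dw z‖ ^ p ∂(ParabolicSystem.cylinderMeasure E T)
            ≤ C * ParabolicSystem.supNorm E T (fun z => a z - b z) ^ (p / (p - 1))
              * ParabolicSystem.energy E T p μ Dv) ∧
        ParabolicSystem.energy E T p μ Dw
          ≤ C * (1 + ParabolicSystem.supNorm E T (fun z => a z - b z) ^ p
              + ParabolicSystem.supNorm E T (fun z => a z - b z) ^ (p / (p - 1)))
            * ParabolicSystem.energy E T p μ Dv := by
  intro p hp C₀ hC₀
  have hp0 : 0 < p := by linarith
  have hp1 : 0 < p - 1 := by linarith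
  have hq : 0 < p / (p - 1) := by positivity
  obtain ⟨K₁, hK₁, H₁⟩ : ∃ K₁ : ℝ, 0 < K₁ ∧ ∀ A : ℝ, 0 < A → p < 2 → ∃ Λ : ℝ, 0 ≤ Λ ∧
      ∀ (N k : ℕ) (μ α β : ℝ) (ξ η : ParabolicSystem.GradSpace k N), 0 < μ → C₀ ≤ β → |α - β| ≤ A →
      ‖ξ - η‖ ^ p ≤ Λ * inner ℝ (β • ParabolicSystem.flux p μ ξ - α • ParabolicSystem.flux p μ η)
        (ξ - η) + K₁ * (A ^ p + A ^ (p / (p - 1))) * (μ ^ 2 + ‖η‖ ^ 2) ^ (p / 2) := by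
    by_cases hp2 : p < 2
    · obtain ⟨K, hK, H⟩ := ParabolicSystem.norm_sub_rpow_le_sub hp hp2 hC₀
      exact ⟨K, hK, fun A hA _ => H A hA⟩
    · exact ⟨1, one_pos, fun A hA h => absurd h hp2⟩
  set K₂ : ℝ := (2 ^ p / C₀) ^ (p / (p - 1)) with hK₂
  have hK₂0 : 0 < K₂ := by positivity
  -- The factor 4^p and the summand 1 serve the energy bound for Dw; K₁ and K₂ come from the ranges
  -- p < 2 and p ≥ 2.
  refine ⟨4 ^ p * (1 + K₁ + K₂), by positivity, ?_⟩
  intro N k E T μ C₁ a b v w Dv Dw hEo hE hT hμ _ ha _ hb hb₀ hv hw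
  set A := ParabolicSystem.supNorm E T (fun z => a z - b z) with hA
  have hA0 : 0 ≤ A := ENNReal.toReal_nonneg
  set e := ParabolicSystem.energy E T p μ Dv with he
  have he0 : 0 ≤ e := integral_nonneg fun z => by positivity
  have h4 : (1 : ℝ) ≤ 4 ^ p := Real.one_le_rpow (by norm_num) hp0.le
  have hAp : 0 ≤ A ^ p := by positivity
  have hAq : 0 ≤ A ^ (p / (p - 1)) := by positivity
  have hsup : 2 ≤ p → ∫ z, ‖Dv z - Dw z‖ ^ p ∂(ParabolicSystem.cylinderMeasure E T)
      ≤ K₂ * A ^ (p / (p - 1)) * e := by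
    intro hp2
    refine ParabolicSystem.le_of_forall_gt_le_of_continuous (f := fun A => K₂ * A ^ (p / (p - 1)) * e)
      ((continuous_const.mul (Real.continuous_rpow_const hq.le)).mul continuous_const)
      fun A' hA' => ?_
    exact ParabolicSystem.integral_norm_sub_rpow_le hp hμ hEo hE hT ha hb hv hw
      (by positivity : 0 ≤ 2 ^ p / C₀) hb₀ hA'.le (fun α β ξ η hβ hαβ =>
        ParabolicSystem.norm_sub_rpow_le hp2 hμ hC₀ (hA0.trans_lt hA') hβ hαβ)
  have hsub : p < 2 → ∫ z, ‖Dv z - Dw z‖ ^ p ∂(ParabolicSystem.cylinderMeasure E T)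
      ≤ K₁ * (A ^ p + A ^ (p / (p - 1))) * e := by
    intro hp2
    refine ParabolicSystem.le_of_forall_gt_le_of_continuous
      (f := fun A => K₁ * (A ^ p + A ^ (p / (p - 1))) * e)
      ((continuous_const.mul ((Real.continuous_rpow_const hp0.le).add
        (Real.continuous_rpow_const hq.le))).mul continuous_const)
      fun A' hA' => ?_
    obtain ⟨Λ, hΛ, H⟩ := H₁ A' (hA0.trans_lt hA') hp2
    exact ParabolicSystem.integral_norm_sub_rpow_le hp hμ hEo hE hT ha hb hv hw
      hΛ hb₀ hA'.le (fun α β ξ η hβ hαβ => H N k μ α β ξ η hμ hβ hαβ)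
  have hmain : ∫ z, ‖Dv z - Dw z‖ ^ p ∂(ParabolicSystem.cylinderMeasure E T)
      ≤ (K₁ + K₂) * (A ^ p + A ^ (p / (p - 1))) * e := by
    rcases lt_or_ge p 2 with hp2 | hp2
    · refine (hsub hp2).trans ?_
      gcongr
      linarith
    · refine (hsup hp2).trans ?_
      gcongr
      · linarith
      · linarith
  refine ⟨hmain.trans ?_, fun hp2 => (hsup hp2).trans ?_, ?_⟩
  · gcongr
    nlinarith
  · gcongr
    nlinarith
  · refine (ParabolicSystem.energy_le hp hμ hE hv.sobolev.memLp_grad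
      hw.sobolev.memLp_grad).trans ?_
    rw [mul_assoc, mul_assoc]
    gcongr
    have h5 : e ≤ 1 * 1 * e := by linarith
    have h6 : 0 ≤ (K₁ + K₂) * e := by positivity
    have h7 : 0 ≤ (A ^ p + A ^ (p / (p - 1))) * e := by positivity
    nlinarith
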